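/- **Logic.** Fix a set $\Pi$ of atomic formulas and a relation $s\vdash p$ ("the state $s\subseteq\Pi$ entails $p\in\Pi$"). A trace is a nonempty finite sequence $\rho=\rho_0\dots\rho_n$ with $\rho_i\subseteq\Pi$. $\mathbb B$ is the set of Boolean expressions built from $\mathit{true},\mathit{false}$ and elements of $\Pi$ with $\neg,\wedge,\vee,\to$. Past-time MTL formulas use in addition $\mathcal Y\phi$, $\mathcal O_I\phi$, $\mathcal H_I\phi$, $\phi\,\mathcal S_I\,\psi$, where $I$ is an interval $[l,u]$ of natural numbers with $l\le u$, or $[0,\infty)$ if omitted. With the usual clauses for the connectives, satisfaction at time $t$ is: $\rho\models_t p$ iff $\rho_t\vdash p$; $\rho\models_t\mathcal Y\phi$ iff $t\ne0$ and $\rho\models_{t-1}\phi$; $\rho\models_t\mathcal O_I\phi$ (resp. $\mathcal H_I\phi$) iff $\rho\models_{t_0}\phi$ for some (resp. every) $t_0\le t$ with $t-t_0\in I$; $\rho\models_t\phi\,\mathcal S_I\,\psi$ iff for some $t_0\le t$ with $t-t_0\in I$ one has $\rho\models_{t_0}\psi$ and $\rho\models_{t_1}\phi$ for all $t_0<t_1\le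 t$. Write $\rho\models\phi$ for $\rho\models_n\phi$. Abbreviate $\phi\,\mathrm{SIR}\,\psi=\phi\,\mathcal S\,(\phi\wedge\psi)$, $\phi\,\mathrm{SIO}\,\psi=\mathcal O\psi\to(\phi\,\mathcal S\,(\phi\wedge\psi))$, $\mathcal Y^m\phi=\mathcal O_{[m,m]}\phi$; and $\mathcal O_{[0,-1]}\phi=\mathit{false}$. **Requirements.** A FRETish requirement is $r=\langle\mathit{scope},\mathit{timing},\mathit{cond},\mathit{res}\rangle$ where, for $\mathit{mode},\mathit{stop}\in\mathbb B$ and $d\in\mathbb N$: the scope is $\mathit{null}$, $\mathit{in}$, $\mathit{notIn}$, $\mathit{before}$, $\mathit{after}$, $\mathit{onlyIn}$, $\mathit{onlyBefore}$ or $\mathit{onlyAfter}$ (each but $\mathit{null}$ with argument $\mathit{mode}$); the timing is $\mathit{immediately}$, $\mathit{next}$, $\mathit{always}$, $\mathit{never}$, $\mathit{eventually}$, $\mathit{within}(d)$, $\mathit{for}(d)$, $\mathit{after}(d)$, $\mathit{until}(\mathit{stop})$ or $\mathit{before}(\mathit{stop})$; $\mathit{cond}\in\mathbb B\cup\{\mathit{null}\}$;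 $\mathit{res}\in\mathbb B$. The *body* of $r$ is a Boolean combination of pairs (timing, response) not involving $\mathit{never}$ and $\mathit{after}$: it is $(\mathit{always},\neg\mathit{res})$ for $\mathit{never}$; $(\mathit{for}(d),\neg\mathit{res})\wedge(\mathit{within}(d+1),\mathit{res})$ for $\mathit{after}(d)$; and $(\mathit{timing},\mathit{res})$ otherwise. For the three "only" scopes it is replaced by its dual: each pair $(\tau,\psi)$ becomes $(\mathrm{dual}(\tau),\neg\psi)$ and $\wedge$ becomes $\vee$, where dual exchanges $\mathit{always}$ and $\mathit{eventually}$, $\mathit{within}(d)$ and $\mathit{for}(d)$, $\mathit{before}(\mathit{stop})$ and $\mathit{until}(\mathit{stop})$, and fixes $\mathit{immediately}$ and $\mathit{next}$. **Denotational semantics.** For $\psi\in\mathbb B$ let $[\![\psi]\!]_\rho$ be the list, in increasing order, of the maximal intervals of $\{i\le n:\rho\models_i\psi\}$; write $i\in[\![\psi]\!]_\rho$ if $i$ lies in one of them. Let $M=[\![\mathit{mode}]\!]_\rho$ and, if $M$ is nonempty, let $[a,b]$ be its first interval. The list of scope intervals is: $\langle[0,n]\rangle$ for $\mathit{null}$;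 $M$ for $\mathit{in}$; the list of maximal intervals of the complement of $M$ in $[0,n]$ for $\mathit{notIn}$ and $\mathit{onlyIn}$; $\langle[b+1,n]\rangle$ for $\mathit{after}$ (empty if $M$ is empty or $b=n$); $\langle[0,a-1]\rangle$ for $\mathit{before}$ (empty if $a=0$, and $\langle[0,n]\rangle$ if $M$ is empty); $\langle[0,b]\rangle$ for $\mathit{onlyAfter}$ ($\langle[0,n]\rangle$ if $M$ is empty); $\langle[a,n]\rangle$ for $\mathit{onlyBefore}$ (empty if $M$ is empty). For an interval $I=[l,u]$, the set $T$ of triggers is $\{l\}$ if $\mathit{cond}=\mathit{null}$, and otherwise $\{\max(\min J,l): J$ an interval of $[\![\mathit{cond}]\!]_\rho$ with $J\cap I\ne\emptyset\}$. Let $S=\{s\in I: s\in[\![\mathit{stop}]\!]_\rho\}$ and $\mathrm{fs}(t)=\min\{s\in S: t\le s\}$, or $u+1$ if there is no such $s$. With $R=[\![\psi]\!]_\rho$, the interval $I$ satisfies $(\tau,\psi)$ iff $T=\emptyset$ or - $\mathit{immediately}$: $t\in R$ for all $t\in T$; - $\mathit{next}$: for all $t\in T$, $t+1\in I$ implies $t+1\in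 R$; - $\mathit{always}$: $j\in R$ for all $j\in[\min T,u]$; - $\mathit{eventually}$: $j\in R$ for some $j\in[\max T,u]$; - $\mathit{within}(d)$: for all $t\in T$, $t+d\in I$ implies $t+k\in I\cap R$ for some $k\le d$; - $\mathit{for}(d)$: for all $t\in T$ and $k\le d$, $t+k\in I$ implies $t+k\in R$; - $\mathit{until}(\mathit{stop})$: for all $t\in T$, every $x$ with $t\le x<\mathrm{fs}(t)$ is in $R$; - $\mathit{before}(\mathit{stop})$: $S=\emptyset$, or for all $t\in T$, $\mathrm{fs}(t)=u+1$ or some $x$ with $t\le x<\mathrm{fs}(t)$ is in $R$. For bodies, $\wedge$ and $\vee$ are read as "and" and "or". The semantics $[\![r]\!]$ is the set of traces $\rho$ such that every scope interval satisfies the body of $r$ (so $\rho\in[\![r]\!]$ if there are no scope intervals). **Formula generation.** Let $\mathit{ftp}=\neg\mathcal Y\,\mathit{true}$, and for $m=\mathit{mode}$ let $\mathit{fim}=m\wedge(\mathit{ftp}\vee\mathcal Y\neg m)$, $\mathit{lim}=\neg m\wedge\mathcal Ym$, $\mathit{fnim}=\neg m\wedge(\mathit{ftp}\vee\mathcal Ym)$,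 $\mathit{lnim}=m\wedge\mathcal Y\neg m$, $\mathit{ffim}=\mathit{fim}\wedge(\mathit{ftp}\vee\mathcal Y\mathcal H\neg m)$, $\mathit{flim}=\mathit{lim}\wedge\mathcal Y\mathcal H\neg\mathit{lim}$. The endpoints (left $L$, right $E$) of the scopes are: $\mathit{null}$: $(\mathit{ftp},-)$; $\mathit{before}$: $(\mathit{ftp},\mathit{ffim})$; $\mathit{after}$: $(\mathit{flim},-)$; $\mathit{in}$: $(\mathit{fim},\mathit{lim})$; $\mathit{notIn}$ and $\mathit{onlyIn}$: $(\mathit{fnim},\mathit{lnim})$; $\mathit{onlyBefore}$: $(\mathit{ffim},-)$; $\mathit{onlyAfter}$: $(\mathit{ftp},\mathit{flim})$. For $c\in\mathbb B$ let $\mathit{Tr}=(c\wedge\mathcal Y\neg c)\vee(c\wedge L)$ and $\mathit{NT}=(\neg c)\,\mathrm{SIR}\,L$. The core formula of $(\tau,\psi)$, first for $\mathit{cond}=\mathit{null}$ and then for $\mathit{cond}=c\in\mathbb B$, is: - $\mathit{immediately}$: $L\to\psi$; $\ \mathit{Tr}\to\psi$. - $\mathit{next}$: $\mathcal YL\to\psi$;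 $\ \mathcal Y\mathit{Tr}\to(\psi\vee L)$. - $\mathit{always}$: $\psi$; $\ \mathit{NT}\vee(\psi\,\mathrm{SIR}\,\mathit{Tr})$. - $\mathit{eventually}$: $\neg(\neg\psi\,\mathrm{SIR}\,L)$; $\ \mathit{NT}\vee\neg(\neg\psi\,\mathrm{SIR}\,\mathit{Tr})$. - $\mathit{until}(\mathit{stop})$: $(\neg\mathit{stop}\,\mathrm{SIR}\,L)\to\psi$; $\ \mathit{NT}\vee((\neg\mathit{stop}\,\mathrm{SIR}\,\mathit{Tr})\to\psi)$. - $\mathit{before}(\mathit{stop})$: $\mathit{stop}\to(\neg L\wedge\neg\mathcal Y(\neg\psi\,\mathrm{SIR}\,L))$; $\ \mathit{stop}\to(\mathit{NT}\vee(\neg L\wedge\neg\mathit{Tr}\wedge\neg\mathcal Y(\neg\psi\,\mathrm{SIR}\,\mathit{Tr})))$. - $\mathit{for}(d)$: $\mathcal O_{[0,d]}L\to\psi$; $\ \mathcal O_{[0,d]}\mathit{Tr}\to(\mathit{NT}\vee\psi)$. - $\mathit{within}(d)$: $(\neg\psi\,\mathrm{SIR}\,L)\to\mathcal O_{[0,d-1]}L$;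 $\ \mathcal Y^d(\mathit{Tr}\wedge\neg\psi)\to\mathcal O_{[0,d-1]}(L\vee\psi)$. With core formula $C$, a pair with timing $\mathit{eventually}$ has $\mathit{base}=E\to\mathcal YC$ and $\mathit{baseLast}=\mathcal OL\to C$; any other pair has $\mathit{base}=E\to\mathcal Y(C\,\mathrm{SIO}\,L)$ and $\mathit{baseLast}=C\,\mathrm{SIO}\,L$. For bodies, $\mathit{base}$ and $\mathit{baseLast}$ are formed from those of the pairs with the same connectives $\wedge,\vee$. Finally, for the body of $r$, $\mathrm{genform}(r)$ is $\mathit{baseLast}$ if the scope has no right endpoint ($\mathit{null},\mathit{after},\mathit{onlyBefore}$), and otherwise $$\mathcal H(\mathit{base}\vee\mathit{ftp})\ \wedge\ \bigl((\neg E\,\mathrm{SIR}\,L)\to\mathit{baseLast}\bigr).$$ **Theorem.** For every FRETish requirement $r$ and every trace $\rho$, $\quad\rho\in[\![r]\!]\iff\rho\models\mathrm{genform}(r)$. -/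

import Mathlib

namespace Fret

/-! ### Intervals and ordered lists of intervals -/

/-- A closed interval `[lb, ub]` of natural numbers with `lb ≤ ub`. -/
@[ext]
structure NatInterval where
  lb : ℕ
  ub : ℕ
  le : lb ≤ ub

instance : Membership ℕ NatInterval where
  mem I x := I.lb ≤ x ∧ x ≤ I.ub

/-- An ordered list of intervals: a finite list `[a₀, b₀], …, [aₖ, bₖ]` of intervals with
`bᵢ + 1 < aᵢ₊₁`. -/
@[ext]
structure OLI where
  toList : List NatInterval
  chain : toList.IsChain (fun I J => I.ub + 1 < J.lb)

namespace OLI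

instance : Membership ℕ OLI where
  mem l x := ∃ I ∈ l.toList, x ∈ I

/-- The empty ordered list of intervals. -/
def empty : OLI := ⟨[], List.isChain_nil⟩

/-- The ordered list consisting of one interval. -/
def single (I : NatInterval) : OLI := ⟨[I], List.isChain_singleton I⟩

section ofPred
open Classical

/-- The maximal interval of points `≤ n` that starts at `a` and on which `P` holds
(for `a ≤ n` with `P a`). -/
noncomputable def run (P : ℕ → Prop) (n a : ℕ) : NatInterval where
  lb := a
  ub := max a (Nat.findGreatest (fun b => ∀ c, a ≤ c → c ≤ b → P c) n)
  le := le_max_left _ _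

/-- The points `a ≤ n` at which `P` holds but does not hold immediately before. -/
noncomputable def starts (P : ℕ → Prop) (n : ℕ) : List ℕ :=
  (List.range (n + 1)).filter (fun a => P a ∧ (a = 0 ∨ ¬ P (a - 1)))

theorem mem_starts {P : ℕ → Prop} {n a : ℕ} :
    a ∈ starts P n ↔ a ≤ n ∧ P a ∧ (a = 0 ∨ ¬ P (a - 1)) := by
  simp [starts]

theorem run_spec {P : ℕ → Prop} {n a : ℕ} (ha : a ≤ n) (hP : P a) :
    (run P n a).ub ≤ n ∧ ∀ c, a ≤ c → c ≤ (run P n a).ub → P c := by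
  have h0 : ∀ c, a ≤ c → c ≤ a → P c := fun c h1 h2 => by
    obtain rfl := le_antisymm h1 h2
    exact hP
  have h1 : a ≤ Nat.findGreatest (fun b => ∀ c, a ≤ c → c ≤ b → P c) n :=
    Nat.le_findGreatest ha h0
  have h2 : (run P n a).ub = Nat.findGreatest (fun b => ∀ c, a ≤ c → c ≤ b → P c) n :=
    max_eq_right h1
  rw [h2]
  exact ⟨Nat.findGreatest_le n,
    Nat.findGreatest_spec (P := fun b => ∀ c, a ≤ c → c ≤ b → P c) ha h0⟩

/-- The ordered list of the maximal intervals on which `P` holds, among the points `≤ n`;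
it encodes the set of all `i ≤ n` with `P i` (see `mem_ofPred`). -/
noncomputable def ofPred (P : ℕ → Prop) (n : ℕ) : OLI where
  toList := (starts P n).map (run P n)
  chain := by
    apply List.Pairwise.isChain
    rw [List.pairwise_map]
    have hs : (starts P n).Pairwise (· < ·) := List.pairwise_lt_range.filter _
    refine hs.imp_of_mem ?_
    intro a b ha hb hab
    rw [mem_starts] at ha hb
    have hspec := run_spec ha.1 ha.2.1
    have hnP : ¬ P (b - 1) := by
      rcases hb.2.2 with h | h
      · omega
      · exact h
    by_contra hcon
    have hcon' : b ≤ (run P n a).ub + 1 := not_lt.mp hcon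
    exact hnP (hspec.2 (b - 1) (by omega) (by omega))

theorem mem_ofPred {P : ℕ → Prop} {n i : ℕ} : i ∈ ofPred P n ↔ i ≤ n ∧ P i := by
  constructor
  · rintro ⟨I, hI, hi⟩
    obtain ⟨a, ha, rfl⟩ := List.mem_map.mp hI
    rw [mem_starts] at ha
    have hspec := run_spec ha.1 ha.2.1
    exact ⟨hi.2.trans hspec.1, hspec.2 i hi.1 hi.2⟩
  · rintro ⟨hin, hPi⟩
    have hex : ∃ a, a ≤ i ∧ ∀ c, a ≤ c → c ≤ i → P c := ⟨i, le_rfl, fun c h1 h2 => by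
      obtain rfl := le_antisymm h1 h2
      exact hPi⟩
    have hf := Nat.find_spec hex
    set a := Nat.find hex with ha
    refine ⟨run P n a, List.mem_map.mpr ⟨a, mem_starts.mpr ⟨hf.1.trans hin, hf.2 a le_rfl hf.1, ?_⟩,
      rfl⟩, hf.1, ?_⟩
    · by_contra hcon
      push Not at hcon
      refine Nat.find_min hex (m := a - 1) (by omega) ⟨by omega, fun c h1 h2 => ?_⟩
      rcases Nat.lt_or_ge c a with h | h
      · have : c = a - 1 := by omega
        rw [this]
        exact hcon.2
      · exact hf.2 c h h2
    · exact le_max_of_le_right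
        (Nat.le_findGreatest (P := fun b => ∀ c, a ≤ c → c ≤ b → P c) hin hf.2)

end ofPred

/-- The complement of `l` within `[0, n]`. -/
noncomputable def compl (l : OLI) (n : ℕ) : OLI := ofPred (fun x => ¬ x ∈ l) n

end OLI

/-! ### Past-time metric temporal logic -/

/-- A nonempty finite trace `ρ₀ … ρₙ` (`n = last`) of states, each a set of atomic formulas. -/
structure Trace (AP : Type*) where
  last : ℕ
  state : Fin (last + 1) → Set AP

/-- Past-time MTL formulas. The interval `none` is `[0, +∞)`. -/
inductive MTL (AP : Type*) where
  | tt : MTL AP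
  | ff : MTL AP
  | atom (p : AP) : MTL AP
  | not (φ : MTL AP) : MTL AP
  | and (φ ψ : MTL AP) : MTL AP
  | or (φ ψ : MTL AP) : MTL AP
  | imp (φ ψ : MTL AP) : MTL AP
  | prev (φ : MTL AP) : MTL AP
  | once (I : Option NatInterval) (φ : MTL AP) : MTL AP
  | hist (I : Option NatInterval) (φ : MTL AP) : MTL AP
  | since (I : Option NatInterval) (φ ψ : MTL AP) : MTL AP

/-- Membership of a distance in an optional interval, `none` being `[0, +∞)`. -/
def InBound : Option NatInterval → ℕ → Prop
  | none, _ => True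
  | some I, k => k ∈ I

/-- `Sat entails ρ φ t`: the formula `φ` holds in `ρ` at time `t`. Here `entails s p` says that the
state `s` entails the atomic formula `p` in the underlying theory. -/
def Sat {AP : Type*} (entails : Set AP → AP → Prop) (ρ : Trace AP) : MTL AP → ℕ → Prop
  | .tt, _ => True
  | .ff, _ => False
  | .atom p, t => ∃ h : t < ρ.last + 1, entails (ρ.state ⟨t, h⟩) p
  | .not φ, t => ¬ Sat entails ρ φ t
  | .and φ ψ, t => Sat entails ρ φ t ∧ Sat entails ρ ψ t
  | .or φ ψ, t => Sat entails ρ φ t ∨ Sat entails ρ ψ t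
  | .imp φ ψ, t => ¬ Sat entails ρ φ t ∨ Sat entails ρ ψ t
  | .prev φ, t => t ≠ 0 ∧ Sat entails ρ φ (t - 1)
  | .once I φ, t => ∃ t₀, t₀ ≤ t ∧ InBound I (t - t₀) ∧ Sat entails ρ φ t₀
  | .hist I φ, t => ∀ t₀, t₀ ≤ t ∧ InBound I (t - t₀) → Sat entails ρ φ t₀
  | .since I φ ψ, t => ∃ t₀, t₀ ≤ t ∧ InBound I (t - t₀) ∧ Sat entails ρ ψ t₀ ∧
      ∀ t₁, t₀ < t₁ → t₁ ≤ t → Sat entails ρ φ t₁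

/-- `ρ ⊨ φ`: the formula holds at the last state of the trace. -/
def Models {AP : Type*} (entails : Set AP → AP → Prop) (ρ : Trace AP) (φ : MTL AP) : Prop :=
  Sat entails ρ φ ρ.last

namespace MTL
variable {AP : Type*}

/-- Since-inclusive-required. -/
def sir (φ ψ : MTL AP) : MTL AP := .since none φ (.and φ ψ)

/-- Since-inclusive-optional. -/
def sio (φ ψ : MTL AP) : MTL AP := .imp (.once none ψ) (.since none φ (.and φ ψ))

/-- `φ` holds exactly `m` steps before. -/
def prevN (m : ℕ) (φ : MTL AP) : MTL AP := .once (some ⟨m, m, le_rfl⟩) φ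

/-- Once within `[0, m]`. -/
def onceUpTo (m : ℕ) (φ : MTL AP) : MTL AP := .once (some ⟨0, m, Nat.zero_le m⟩) φ

/-- Once within `[0, m - 1]`; for `m = 0` this interval is empty and the formula is false. -/
def onceBelow : ℕ → MTL AP → MTL AP
  | 0, _ => .ff
  | m + 1, φ => onceUpTo m φ

end MTL

/-! ### Requirements -/

/-- Non-temporal Boolean expressions. -/
inductive BExpr (AP : Type*) where
  | tt : BExpr AP
  | ff : BExpr AP
  | atom (p : AP) : BExpr AP
  | not (φ : BExpr AP) : BExpr AP
  | and (φ ψ : BExpr AP) : BExpr AP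
  | or (φ ψ : BExpr AP) : BExpr AP
  | imp (φ ψ : BExpr AP) : BExpr AP

/-- A Boolean expression as an MTL formula. -/
def BExpr.toMTL {AP : Type*} : BExpr AP → MTL AP
  | .tt => .tt
  | .ff => .ff
  | .atom p => .atom p
  | .not φ => .not φ.toMTL
  | .and φ ψ => .and φ.toMTL ψ.toMTL
  | .or φ ψ => .or φ.toMTL ψ.toMTL
  | .imp φ ψ => .imp φ.toMTL ψ.toMTL

/-- The eight scopes; `global` is the null scope. -/
inductive Scope (AP : Type*) where
  | global : Scope AP
  | inMode (mode : BExpr AP) : Scope AP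
  | notIn (mode : BExpr AP) : Scope AP
  | before (mode : BExpr AP) : Scope AP
  | after (mode : BExpr AP) : Scope AP
  | onlyAfter (mode : BExpr AP) : Scope AP
  | onlyBefore (mode : BExpr AP) : Scope AP
  | onlyIn (mode : BExpr AP) : Scope AP

/-- The eight timings that are not defined through other timings. -/
inductive BasicTiming (AP : Type*) where
  | immediately : BasicTiming AP
  | next : BasicTiming AP
  | always : BasicTiming AP
  | eventually : BasicTiming AP
  | within (d : ℕ) : BasicTiming AP
  | for (d : ℕ) : BasicTiming AP
  | until (stopExpr : BExpr AP) : BasicTiming AP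
  | before (stopExpr : BExpr AP) : BasicTiming AP

/-- The ten timings. -/
inductive Timing (AP : Type*) where
  | basic (τ : BasicTiming AP) : Timing AP
  | never : Timing AP
  | after (d : ℕ) : Timing AP

/-- A requirement; `cond = none` is the null condition. -/
structure Requirement (AP : Type*) where
  scope : Scope AP
  timing : Timing AP
  cond : Option (BExpr AP)
  res : BExpr AP

/-- The scopes of type "only". -/
def Scope.isOnly {AP : Type*} : Scope AP → Bool
  | .onlyAfter _ => true
  | .onlyBefore _ => true
  | .onlyIn _ => true
  | _ => false

/-- The dual of a timing. -/
def BasicTiming.dual {AP : Type*} : BasicTiming AP → BasicTiming AP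
  | .always => .eventually
  | .eventually => .always
  | .within d => .for d
  | .for d => .within d
  | .before stopExpr => .until stopExpr
  | .until stopExpr => .before stopExpr
  | .immediately => .immediately
  | .next => .next

/-- The temporal body of a requirement: a Boolean combination of pairs (timing, response).
Only the bodies produced by `Timing.body` and `Body.dual` are used. -/
inductive Body (AP : Type*) where
  | single (τ : BasicTiming AP) (res : BExpr AP) : Body AP
  | and (b₁ b₂ : Body AP) : Body AP
  | or (b₁ b₂ : Body AP) : Body AP

/-- The body of a timing and a response: `never` is `always` for the negated response, and `after d`
is `for d` for the negated response together with `within (d + 1)`. -/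
def Timing.body {AP : Type*} : Timing AP → BExpr AP → Body AP
  | .basic τ, res => .single τ res
  | .never, res => .single .always (.not res)
  | .after d, res => .and (.single (.for d) (.not res)) (.single (.within (d + 1)) res)

/-- The dual body: dual timing and negated response. -/
def Body.dual {AP : Type*} : Body AP → Body AP
  | .single τ res => .single τ.dual (.not res)
  | .and b₁ b₂ => .or b₁.dual b₂.dual
  | .or b₁ b₂ => .and b₁.dual b₂.dual

/-- The body that has to hold in every scope interval: dualized for the "only" scopes. -/
def Requirement.body {AP : Type*} (r : Requirement AP) : Body AP :=
  if r.scope.isOnly then (r.timing.body r.res).dual else r.timing.body r.res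

/-! ### Denotational semantics -/

section Semantics
variable {AP : Type*} (entails : Set AP → AP → Prop) (ρ : Trace AP)

/-- The ordered list of intervals that encodes where `ψ` holds in `ρ`. -/
noncomputable def boolSem (ψ : BExpr AP) : OLI :=
  OLI.ofPred (Sat entails ρ ψ.toMTL) ρ.last

theorem mem_boolSem {ψ : BExpr AP} {i : ℕ} :
    i ∈ boolSem entails ρ ψ ↔ i ≤ ρ.last ∧ Sat entails ρ ψ.toMTL i := OLI.mem_ofPred

/-- The interval `[a, b]` as an ordered list, empty when `b < a`. -/
def segment (a b : ℕ) : OLI :=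
  if h : a ≤ b then OLI.single ⟨a, b, h⟩ else OLI.empty

/-- The intervals in which the body of a requirement is imposed. -/
noncomputable def scopeSem : Scope AP → OLI
  | .global => segment 0 ρ.last
  | .inMode mode => boolSem entails ρ mode
  | .notIn mode => (boolSem entails ρ mode).compl ρ.last
  | .after mode =>
      match (boolSem entails ρ mode).toList with
      | [] => OLI.empty
      | J :: _ => segment (J.ub + 1) ρ.last
  | .before mode =>
      match (boolSem entails ρ mode).toList with
      | [] => segment 0 ρ.last
      | J :: _ => if J.lb = 0 then OLI.empty else segment 0 (J.lb - 1)
  | .onlyIn mode => (boolSem entails ρ mode).compl ρ.last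
  | .onlyAfter mode =>
      match (boolSem entails ρ mode).toList with
      | [] => segment 0 ρ.last
      | J :: _ => segment 0 J.ub
  | .onlyBefore mode =>
      match (boolSem entails ρ mode).toList with
      | [] => OLI.empty
      | J :: _ => segment J.lb ρ.last

/-- The triggers of a condition in the interval `I`. -/
def triggers (cond : Option (BExpr AP)) (I : NatInterval) : Set ℕ :=
  match cond with
  | none => {I.lb}
  | some c => {m | ∃ J ∈ (boolSem entails ρ c).toList, (∃ x, x ∈ J ∧ x ∈ I) ∧ m = max J.lb I.lb}

/-- The indices of `I` at which the stop condition is satisfied. -/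
def stops (stopExpr : BExpr AP) (I : NatInterval) : Set ℕ :=
  {s | s ∈ I ∧ s ∈ boolSem entails ρ stopExpr}

open Classical in
/-- The first index of `I` from `t` on at which the stop condition is satisfied, or `I.ub + 1` if
there is none. -/
noncomputable def firstStop (stopExpr : BExpr AP) (t : ℕ) (I : NatInterval) : ℕ :=
  if ∃ s ∈ stops entails ρ stopExpr I, t ≤ s then sInf {s | s ∈ stops entails ρ stopExpr I ∧ t ≤ s}
  else I.ub + 1

/-- The intervals in which the response is satisfied as the timing requires. -/
def timeSem (cond : Option (BExpr AP)) (res : BExpr AP) : BasicTiming AP → Set NatInterval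
  | .immediately =>
      {I | triggers entails ρ cond I = ∅} ∪
      {I | (triggers entails ρ cond I).Nonempty ∧
        ∀ t ∈ triggers entails ρ cond I, t ∈ boolSem entails ρ res}
  | .next =>
      {I | triggers entails ρ cond I = ∅} ∪
      {I | (triggers entails ρ cond I).Nonempty ∧
        ∀ t ∈ triggers entails ρ cond I, t + 1 ∈ I → t + 1 ∈ boolSem entails ρ res}
  | .always =>
      {I | triggers entails ρ cond I = ∅} ∪
      {I | (triggers entails ρ cond I).Nonempty ∧
        ∃ m, IsLeast (triggers entails ρ cond I) m ∧
          ∀ j, m ≤ j → j ≤ I.ub → j ∈ boolSem entails ρ res}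
  | .eventually =>
      {I | triggers entails ρ cond I = ∅} ∪
      {I | (triggers entails ρ cond I).Nonempty ∧
        ∃ m, IsGreatest (triggers entails ρ cond I) m ∧
          ∃ j, m ≤ j ∧ j ≤ I.ub ∧ j ∈ boolSem entails ρ res}
  | .within d =>
      {I | triggers entails ρ cond I = ∅} ∪
      {I | (triggers entails ρ cond I).Nonempty ∧
        ∀ t ∈ triggers entails ρ cond I, t + d ∈ I →
          ∃ k, k ≤ d ∧ t + k ∈ I ∧ t + k ∈ boolSem entails ρ res}
  | .for d =>
      {I | triggers entails ρ cond I = ∅} ∪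
      {I | (triggers entails ρ cond I).Nonempty ∧
        ∀ t ∈ triggers entails ρ cond I, ∀ k, k ≤ d →
          t + k ∈ I → t + k ∈ boolSem entails ρ res}
  | .until stopExpr =>
      {I | triggers entails ρ cond I = ∅} ∪
      {I | (triggers entails ρ cond I).Nonempty ∧
        ∀ t ∈ triggers entails ρ cond I, ∀ x, t ≤ x → x < firstStop entails ρ stopExpr t I →
          x ∈ boolSem entails ρ res}
  | .before stopExpr =>
      {I | triggers entails ρ cond I = ∅ ∨ stops entails ρ stopExpr I = ∅} ∪
      {I | (triggers entails ρ cond I).Nonempty ∧ (stops entails ρ stopExpr I).Nonempty ∧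
        ∀ t ∈ triggers entails ρ cond I,
          firstStop entails ρ stopExpr t I = I.ub + 1 ∨
          ∃ x, t ≤ x ∧ x < firstStop entails ρ stopExpr t I ∧ x ∈ boolSem entails ρ res}

/-- The intervals in which a body holds. -/
def bodySem (cond : Option (BExpr AP)) : Body AP → Set NatInterval
  | .single τ res => timeSem entails ρ cond res τ
  | .and b₁ b₂ => bodySem cond b₁ ∩ bodySem cond b₂
  | .or b₁ b₂ => bodySem cond b₁ ∪ bodySem cond b₂

end Semantics

/-- The semantics of a requirement: the traces all of whose scope intervals satisfy the body. -/
def fretSem {AP : Type*} (entails : Set AP → AP → Prop) (r : Requirement AP) : Set (Trace AP) :=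
  {ρ | ∀ I ∈ (scopeSem entails ρ r.scope).toList, I ∈ bodySem entails ρ r.cond r.body}

/-! ### Formula generation -/

section Generation
variable {AP : Type*}

/-- A point at which `cond` becomes true, or holds at the left endpoint. -/
def triggerFormula (cond : BExpr AP) (left : MTL AP) : MTL AP :=
  .or (.and cond.toMTL (.prev (.not cond.toMTL))) (.and cond.toMTL left)

/-- `cond` has not held since the left endpoint. -/
def noTriggersFormula (cond : BExpr AP) (left : MTL AP) : MTL AP :=
  .sir (.not cond.toMTL) left

/-- The core formula for the null condition. -/
def coreFormulaNull (res : BExpr AP) (left : MTL AP) : BasicTiming AP → MTL AP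
  | .immediately => .imp left res.toMTL
  | .next => .imp (.prev left) res.toMTL
  | .always => res.toMTL
  | .eventually => .not (.sir (.not res.toMTL) left)
  | .until stopExpr => .imp (.sir (.not stopExpr.toMTL) left) res.toMTL
  | .before stopExpr =>
      .imp stopExpr.toMTL (.and (.not left) (.not (.prev (.sir (.not res.toMTL) left))))
  | .for m => .imp (.onceUpTo m left) res.toMTL
  | .within m => .imp (.sir (.not res.toMTL) left) (.onceBelow m left)

/-- The core formula for a condition `cond`. -/
def coreFormulaCond (cond res : BExpr AP) (left : MTL AP) : BasicTiming AP → MTL AP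
  | .immediately => .imp (triggerFormula cond left) res.toMTL
  | .next => .imp (.prev (triggerFormula cond left)) (.or res.toMTL left)
  | .always => .or (noTriggersFormula cond left) (.sir res.toMTL (triggerFormula cond left))
  | .eventually =>
      .or (noTriggersFormula cond left)
        (.not (.sir (.not res.toMTL) (triggerFormula cond left)))
  | .until stopExpr =>
      .or (noTriggersFormula cond left)
        (.imp (.sir (.not stopExpr.toMTL) (triggerFormula cond left)) res.toMTL)
  | .before stopExpr =>
      .imp stopExpr.toMTL
        (.or (noTriggersFormula cond left)
          (.and (.and (.not left) (.not (triggerFormula cond left)))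
            (.not (.prev (.sir (.not res.toMTL) (triggerFormula cond left))))))
  | .for m =>
      .imp (.onceUpTo m (triggerFormula cond left)) (.or (noTriggersFormula cond left) res.toMTL)
  | .within m =>
      .imp (.prevN m (.and (triggerFormula cond left) (.not res.toMTL)))
        (.onceBelow m (.or left res.toMTL))

/-- The core formula. -/
def coreFormula (τ : BasicTiming AP) (cond : Option (BExpr AP)) (res : BExpr AP)
    (left : MTL AP) : MTL AP :=
  match cond with
  | none => coreFormulaNull res left τ
  | some c => coreFormulaCond c res left τ

/-- The base formula of a timing, for an interval with endpoints `left` and `right`. -/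
def baseForm (τ : BasicTiming AP) (cond : Option (BExpr AP)) (res : BExpr AP)
    (left right : MTL AP) : MTL AP :=
  match τ with
  | .eventually => .imp right (.prev (coreFormula .eventually cond res left))
  | τ => .imp right (.prev (.sio (coreFormula τ cond res left) left))

/-- The base formula of a timing, for an interval that spans to the end of the trace. -/
def baseFormLast (τ : BasicTiming AP) (cond : Option (BExpr AP)) (res : BExpr AP)
    (left : MTL AP) : MTL AP :=
  match τ with
  | .eventually => .imp (.once none left) (coreFormula .eventually cond res left)
  | τ => .sio (coreFormula τ cond res left) left

/-- The base formula of a body. -/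
def bodyBase (cond : Option (BExpr AP)) (left right : MTL AP) : Body AP → MTL AP
  | .single τ res => baseForm τ cond res left right
  | .and b₁ b₂ => .and (bodyBase cond left right b₁) (bodyBase cond left right b₂)
  | .or b₁ b₂ => .or (bodyBase cond left right b₁) (bodyBase cond left right b₂)

/-- The base formula of a body, for an interval that spans to the end of the trace. -/
def bodyBaseLast (cond : Option (BExpr AP)) (left : MTL AP) : Body AP → MTL AP
  | .single τ res => baseFormLast τ cond res left
  | .and b₁ b₂ => .and (bodyBaseLast cond left b₁) (bodyBaseLast cond left b₂)
  | .or b₁ b₂ => .or (bodyBaseLast cond left b₁) (bodyBaseLast cond left b₂)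

/-- First time point. -/
def ftp : MTL AP := .not (.prev .tt)

def fim (mode : BExpr AP) : MTL AP :=
  .and mode.toMTL (.or ftp (.prev (.not mode.toMTL)))

def lim (mode : BExpr AP) : MTL AP :=
  .and (.not mode.toMTL) (.prev mode.toMTL)

def fnim (mode : BExpr AP) : MTL AP :=
  .and (.not mode.toMTL) (.or ftp (.prev mode.toMTL))

def lnim (mode : BExpr AP) : MTL AP :=
  .and mode.toMTL (.prev (.not mode.toMTL))

def ffim (mode : BExpr AP) : MTL AP :=
  .and (fim mode) (.or ftp (.prev (.hist none (.not mode.toMTL))))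

def flim (mode : BExpr AP) : MTL AP :=
  .and (lim mode) (.prev (.hist none (.not (lim mode))))

/-- The left endpoint of a scope. -/
def Scope.left : Scope AP → MTL AP
  | .global => ftp
  | .before _ => ftp
  | .after mode => flim mode
  | .inMode mode => fim mode
  | .notIn mode => fnim mode
  | .onlyIn mode => fnim mode
  | .onlyBefore mode => ffim mode
  | .onlyAfter _ => ftp

/-- The right endpoint of a scope, undefined for the scopes that span to the end of the trace. -/
def Scope.right : Scope AP → Option (MTL AP)
  | .global => none
  | .before mode => some (ffim mode)
  | .after _ => none
  | .inMode mode => some (lim mode)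
  | .notIn mode => some (lnim mode)
  | .onlyIn mode => some (lnim mode)
  | .onlyBefore _ => none
  | .onlyAfter mode => some (flim mode)

/-- The past-time MTL formula generated for a requirement. -/
def genform (r : Requirement AP) : MTL AP :=
  match r.scope.right with
  | none => bodyBaseLast r.cond r.scope.left r.body
  | some right =>
      .and (.hist none (.or (bodyBase r.cond r.scope.left right r.body) ftp))
        (.imp (.sir (.not right) r.scope.left) (bodyBaseLast r.cond r.scope.left r.body))

end Generation

end Fret

/-! The list of scope intervals and the temporal formulas meet in one pointwise description. For
every scope, the formulas `L` and `E` delimit the intervals (`IsDelimited`, proved in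
`isDelimited_scopeSem`): inside an interval `[l, u]` the left endpoint holds at `l` only and `E`
nowhere, while `E` holds at `u + 1` unless `u` is the end `n` of the trace. Conversely, every `E` at
a positive time closes an interval, and an `L` not followed by `E` forces an interval ending at `n`.
Time `0` is excluded because `E` may hold there with nothing to its left; this is what the disjunct
`ftp` in the generated formula absorbs.

Inside one interval, the past operators anchored at `L` become local. A witness for `φ SIR L` at `j`
cannot lie in `(l, j]`, so it lies at or before `l` and gives `φ` on all of `[l, j]`; witnesses from
before the interval do no harm. Triggers of earlier intervals are dealt with likewise: a `SIR` with
such a witness asserts more than is needed, and in the other cases a disjunct `NT` or `L`, or a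
bounded window, neutralizes it. Hence, for a timing other than `eventually`, the interval satisfies
the pair iff the core formula holds at every point of `[l, u]`, which is what `SIO L` says at `u`;
for `eventually` the core formula at `u` suffices (`holds_iff_coreFormulaNull`,
`holds_iff_coreFormulaCond` and their `eventually` versions). The denotational side is first put
into a form universal in the triggers (`mem_timeSem`).

For bodies, the equivalence at `u` passes through `∧` and `∨`, so the "only" scopes need no duality
argument. At a point `u + 1` where `E` holds, the base formula is the last-interval formula at `u`;
at points without `E` it is vacuous. So the `H` conjunct covers the intervals ending before `n`, and
the implication covers the one ending at `n`. -/

namespace Fret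

/-! ### Maximal runs -/

namespace OLI

-- Characterizes the maximal runs intrinsically, so that later arguments need neither `run` nor
-- `starts`. If a run could be prolonged by one point, `Nat.findGreatest` would have returned the
-- larger bound.
open Classical in
theorem mem_toList_ofPred {P : ℕ → Prop} {n : ℕ} {I : NatInterval} :
    I ∈ (ofPred P n).toList ↔
      I.ub ≤ n ∧ (∀ x, I.lb ≤ x → x ≤ I.ub → P x) ∧ (I.lb = 0 ∨ ¬ P (I.lb - 1)) ∧
        (I.ub = n ∨ ¬ P (I.ub + 1)) := by
  have key : ∀ a, a ≤ n → P a → ((run P n a).ub = n ∨ ¬ P ((run P n a).ub + 1)) := by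
    intro a ha hPa
    by_contra! hcon
    obtain ⟨hub, hP⟩ := run_spec ha hPa
    have hle : a ≤ (run P n a).ub := (run P n a).le
    have h := Nat.le_findGreatest (P := fun b => ∀ c, a ≤ c → c ≤ b → P c)
      (m := (run P n a).ub + 1) (n := n) (by omega) (by
        intro c h1 h2
        rcases Nat.lt_or_ge (run P n a).ub c with h | h
        · rw [show c = (run P n a).ub + 1 by omega]
          exact hcon.2
        · exact hP c h1 h)
    have h' : Nat.findGreatest (fun b => ∀ c, a ≤ c → c ≤ b → P c) n ≤ (run P n a).ub :=
      le_max_right _ _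
    omega
  constructor
  · intro h
    obtain ⟨a, ha, rfl⟩ := List.mem_map.mp h
    rw [mem_starts] at ha
    have hs := run_spec ha.1 ha.2.1
    exact ⟨hs.1, hs.2, ha.2.2, key a ha.1 ha.2.1⟩
  · rintro ⟨hn, hP, hl, hu⟩
    have hle := I.le
    have ha : I.lb ≤ n := by omega
    have hPa : P I.lb := hP _ le_rfl hle
    refine List.mem_map.mpr ⟨I.lb, mem_starts.mpr ⟨ha, hPa, hl⟩, ?_⟩
    have hs := run_spec ha hPa
    have hk := key _ ha hPa
    have hle' : I.lb ≤ (run P n I.lb).ub := (run P n I.lb).le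
    -- Both intervals start at `I.lb`; if one were shorter, the longer one would make `P` hold just
    -- past its end, against its maximality.
    refine NatInterval.ext rfl (le_antisymm ?_ ?_)
    · by_contra! h
      rcases hu with hu | hu
      · omega
      · exact hu (hs.2 _ (by omega) (by omega))
    · by_contra! h
      rcases hk with hk | hk
      · omega
      · exact hk (hP _ (by omega) (by omega))

theorem not_of_toList_ofPred_eq_nil {P : ℕ → Prop} {n : ℕ} (h : (ofPred P n).toList = [])
    {x : ℕ} (hx : x ≤ n) : ¬ P x := by
  intro hP
  obtain ⟨I, hI, -⟩ := mem_ofPred.mpr ⟨hx, hP⟩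
  simp [h] at hI

/-- The runs are listed by increasing left end, since `starts` filters an increasing range; so no
point satisfying `P` precedes the head of the list. -/
theorem lb_le_of_toList_ofPred_eq_cons {P : ℕ → Prop} {n : ℕ} {J : NatInterval}
    {l : List NatInterval} (h : (ofPred P n).toList = J :: l) {x : ℕ} (hx : x ≤ n) (hP : P x) :
    J.lb ≤ x := by
  obtain ⟨I, hI, hxI⟩ := mem_ofPred.mpr ⟨hx, hP⟩
  have hs : (starts P n).Pairwise (· < ·) := List.pairwise_lt_range.filter _
  have hp : (ofPred P n).toList.Pairwise (fun I J => I.lb < J.lb) := by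
    change ((starts P n).map (run P n)).Pairwise _
    rw [List.pairwise_map]
    exact hs
  rw [h] at hI hp
  rcases List.mem_cons.mp hI with rfl | hI
  · exact hxI.1
  · exact ((List.pairwise_cons.mp hp).1 I hI).le.trans hxI.1

end OLI

/-! ### Scope intervals and their endpoints -/

/-- The intervals of `l` are those delimited within `[0, n]` by the left endpoints `L` and the
right endpoints `E`. -/
structure IsDelimited (L E : ℕ → Prop) (n : ℕ) (l : List NatInterval) : Prop where
  ub_le : ∀ I ∈ l, I.ub ≤ n
  left_iff : ∀ I ∈ l, ∀ j, I.lb ≤ j → j ≤ I.ub → (L j ↔ j = I.lb)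
  not_right : ∀ I ∈ l, ∀ j, I.lb ≤ j → j ≤ I.ub → ¬ E j
  ub_eq_or : ∀ I ∈ l, I.ub = n ∨ E (I.ub + 1)
  exists_of_right : ∀ t ≤ n, t ≠ 0 → E t → ∃ I ∈ l, I.ub + 1 = t
  exists_of_left : ∀ t ≤ n, L t → (∀ x, t ≤ x → x ≤ n → ¬ E x) → ∃ I ∈ l, I.ub = n
  left_succ : ∀ t, L t → ¬ L (t + 1)

theorem exists_first {P : ℕ → Prop} {a b : ℕ} (hab : a ≤ b) (h : P b) :
    ∃ c, a ≤ c ∧ c ≤ b ∧ P c ∧ ∀ x, a ≤ x → x < c → ¬ P x := by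
  classical
  have hex : ∃ c, a ≤ c ∧ P c := ⟨b, hab, h⟩
  refine ⟨Nat.find hex, (Nat.find_spec hex).1, Nat.find_min' hex ⟨hab, h⟩,
    (Nat.find_spec hex).2, fun x hx hlt hP => Nat.find_min hex hlt ⟨hx, hP⟩⟩

theorem exists_last {P : ℕ → Prop} {a b : ℕ} (hab : a ≤ b) (h : P a) :
    ∃ c, a ≤ c ∧ c ≤ b ∧ P c ∧ ∀ x, c < x → x ≤ b → ¬ P x := by
  classical
  refine ⟨Nat.findGreatest P b, Nat.le_findGreatest hab h, Nat.findGreatest_le b,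
    Nat.findGreatest_spec hab h, fun x h1 h2 => Nat.findGreatest_is_greatest h1 h2⟩

/-- Serves the scope `in` with the mode as `P`, and `notIn` and `onlyIn` with its negation. The
disjunctions are spelled as the semantics of `fim` and `fnim` unfolds. -/
theorem isDelimited_runs (P : ℕ → Prop) (n : ℕ) (l : List NatInterval)
    (hl : ∀ I : NatInterval, I ∈ l ↔ I.ub ≤ n ∧ (∀ x, I.lb ≤ x → x ≤ I.ub → P x) ∧
      (I.lb = 0 ∨ ¬ P (I.lb - 1)) ∧ (I.ub = n ∨ ¬ P (I.ub + 1))) :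
    IsDelimited (fun t => P t ∧ (t = 0 ∨ t ≠ 0 ∧ ¬ P (t - 1)))
      (fun t => ¬ P t ∧ t ≠ 0 ∧ P (t - 1)) n l := by
  have hex : ∀ t ≤ n, P t → (t = n ∨ ¬ P (t + 1)) → ∃ I ∈ l, I.ub = t := by
    intro t ht hP htn
    by_cases h : ∃ x, x ≤ t ∧ ¬ P x
    · obtain ⟨x, hx, hPx⟩ := h
      -- With `c` the last failure of `P` up to `t`, the run ending at `t` is `[c + 1, t]`.
      obtain ⟨c, h1, h2, h3, h4⟩ := exists_last (P := fun x => ¬ P x) hx hPx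
      have hct : c ≠ t := by rintro rfl; exact h3 hP
      refine ⟨⟨c + 1, t, by omega⟩, (hl _).mpr ⟨ht, ?_, Or.inr h3, htn⟩, rfl⟩
      intro x hx hxt
      exact not_not.mp (h4 x hx hxt)
    · push Not at h
      exact ⟨⟨0, t, by omega⟩, (hl _).mpr ⟨ht, fun x _ hx => h x hx, Or.inl rfl, htn⟩, rfl⟩
  refine ⟨fun I hI => ((hl I).mp hI).1, ?_, ?_, ?_, ?_, ?_, ?_⟩
  · intro I hI j h1 h2
    obtain ⟨-, h3, h4, -⟩ := (hl I).mp hI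
    constructor
    · rintro ⟨-, h | ⟨h0, h⟩⟩
      · omega
      · by_contra hne
        exact h (h3 _ (by omega) (by omega))
    · rintro rfl
      refine ⟨h3 _ h1 h2, ?_⟩
      tauto
  · intro I hI j h1 h2 h
    exact h.1 (((hl I).mp hI).2.1 j h1 h2)
  · intro I hI
    obtain ⟨-, h3, -, h4⟩ := (hl I).mp hI
    exact h4.imp_right fun h => ⟨h, by omega, h3 _ (by simpa using I.le) (by simp)⟩
  · rintro t ht h0 ⟨h1, -, h2⟩
    obtain ⟨I, hI, hu⟩ := hex (t - 1) (by omega) h2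
      (Or.inr (by rwa [show t - 1 + 1 = t by omega]))
    exact ⟨I, hI, by omega⟩
  · rintro t ht ⟨h1, -⟩ h2
    refine hex n le_rfl ?_ (Or.inl rfl)
    -- Without a right endpoint after `t`, `P` never switches off, so it persists up to `n`.
    refine Nat.le_induction (P := fun k _ => k ≤ n → P k) (fun _ => h1) ?_ n ht le_rfl
    intro k hk ih hkn
    by_contra h
    exact h2 (k + 1) (by omega) hkn ⟨h, by omega, ih (by omega)⟩
  · rintro t ⟨h1, -⟩ ⟨h2, h | ⟨-, h⟩⟩
    · omega
    · exact h h1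

theorem IsDelimited.congr {L E L' E' : ℕ → Prop} {n : ℕ} {l : List NatInterval}
    (h : IsDelimited L E n l) (hL : ∀ t, L' t ↔ L t) (hE : ∀ t, E' t ↔ E t) :
    IsDelimited L' E' n l := by
  obtain rfl : L' = L := funext fun t => propext (hL t)
  obtain rfl : E' = E := funext fun t => propext (hE t)
  exact h

/-- Needed when a degenerate scope has no interval. A left endpoint may still hold, as at time `0`
for `before` when the mode holds initially; it is then cancelled by a simultaneous right endpoint.
-/
theorem isDelimited_nil {L E : ℕ → Prop} {n : ℕ} (hE : ∀ t ≤ n, t ≠ 0 → ¬ E t)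
    (hL : ∀ t ≤ n, L t → E t) (hLL : ∀ t, L t → ¬ L (t + 1)) : IsDelimited L E n [] where
  ub_le := by simp
  left_iff := by simp
  not_right := by simp
  ub_eq_or := by simp
  exists_of_right t ht h0 h := (hE t ht h0 h).elim
  exists_of_left t ht h h' := (h' t le_rfl ht (hL t ht h)).elim
  left_succ := hLL

/-- When `I.ub = n`, the condition on `E` says that it never holds on the trace, so scopes without a
right endpoint are included. -/
theorem isDelimited_singleton {L E : ℕ → Prop} {n : ℕ} {I : NatInterval} (hub : I.ub ≤ n)
    (hL : ∀ t ≤ n, L t ↔ t = I.lb) (hE : ∀ t ≤ n, E t ↔ t = I.ub + 1)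
    (hLL : ∀ t, L t → ¬ L (t + 1)) : IsDelimited L E n [I] where
  ub_le := by simpa
  left_iff := by
    intro J hJ j h1 h2
    obtain rfl := List.mem_singleton.mp hJ
    exact hL j (by omega)
  not_right := by
    intro J hJ j h1 h2
    obtain rfl := List.mem_singleton.mp hJ
    rw [hE j (by omega)]
    omega
  ub_eq_or := by
    intro J hJ
    obtain rfl := List.mem_singleton.mp hJ
    by_cases h : J.ub = n
    · exact Or.inl h
    · exact Or.inr ((hE _ (by omega)).mpr rfl)
  exists_of_right t ht h0 h := ⟨I, by simp, ((hE t ht).mp h).symm⟩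
  exists_of_left t ht h h' := by
    refine ⟨I, by simp, ?_⟩
    by_contra hne
    have hle := I.le
    have := (hL t ht).mp h
    exact h' (I.ub + 1) (by omega) (by omega) ((hE _ (by omega)).mpr rfl)
  left_succ := hLL

section
variable {AP : Type*} {entails : Set AP → AP → Prop} {ρ : Trace AP}

/-! ### Endpoint formulas as conditions on the mode -/

theorem sat_ftp {t : ℕ} : Sat entails ρ ftp t ↔ t = 0 := by
  simp [ftp, Sat]

theorem sat_fim {mode : BExpr AP} {t : ℕ} : Sat entails ρ (fim mode) t ↔
    Sat entails ρ mode.toMTL t ∧ (t = 0 ∨ t ≠ 0 ∧ ¬ Sat entails ρ mode.toMTL (t - 1)) := by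
  simp only [fim, Sat, sat_ftp]

theorem sat_fnim {mode : BExpr AP} {t : ℕ} : Sat entails ρ (fnim mode) t ↔
    ¬ Sat entails ρ mode.toMTL t ∧ (t = 0 ∨ t ≠ 0 ∧ Sat entails ρ mode.toMTL (t - 1)) := by
  simp only [fnim, Sat, sat_ftp]

theorem sat_ffim {mode : BExpr AP} {t : ℕ} : Sat entails ρ (ffim mode) t ↔
    Sat entails ρ mode.toMTL t ∧ ∀ x < t, ¬ Sat entails ρ mode.toMTL x := by
  simp only [ffim, Sat, sat_ftp, sat_fim, InBound, and_true]
  constructor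
  · rintro ⟨⟨h1, -⟩, rfl | ⟨h2, h3⟩⟩
    · exact ⟨h1, by simp⟩
    · exact ⟨h1, fun x hx => h3 x (by omega)⟩
  · rintro ⟨h1, h2⟩
    rcases Nat.eq_zero_or_pos t with rfl | h0
    · exact ⟨⟨h1, Or.inl rfl⟩, Or.inl rfl⟩
    · exact ⟨⟨h1, Or.inr ⟨by omega, h2 _ (by omega)⟩⟩, Or.inr ⟨by omega, fun x hx => h2 x (by omega)⟩⟩

theorem sat_lim {mode : BExpr AP} {t : ℕ} : Sat entails ρ (lim mode) t ↔
    ¬ Sat entails ρ mode.toMTL t ∧ t ≠ 0 ∧ Sat entails ρ mode.toMTL (t - 1) := Iff.rfl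

theorem sat_flim {mode : BExpr AP} {t : ℕ} : Sat entails ρ (flim mode) t ↔
    Sat entails ρ (lim mode) t ∧ ∀ x < t, ¬ Sat entails ρ (lim mode) x := by
  simp only [flim, Sat, InBound, and_true]
  constructor
  · rintro ⟨h1, h2, h3⟩
    exact ⟨h1, fun x hx => h3 x (by omega)⟩
  · rintro ⟨h1, h2⟩
    have h0 := h1.2.1
    exact ⟨h1, h0, fun x hx => h2 x (by omega)⟩

/-- The right endpoint of a scope as a predicate on time points. -/
def Scope.rightSat (entails : Set AP → AP → Prop) (ρ : Trace AP) (s : Scope AP) (t : ℕ) : Prop :=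
  ∃ right ∈ s.right, Sat entails ρ right t

/-- A switch-off of `P` needs `P` one step earlier, hence cannot occur before the first run `J` has
ended. If `J.ub = n`, both sides are false for `t ≤ n`. -/
theorem not_lim_of_first_run {P : ℕ → Prop} {J : NatInterval} {n : ℕ}
    (h1 : ∀ x, J.lb ≤ x → x ≤ J.ub → P x) (h2 : J.ub = n ∨ ¬ P (J.ub + 1))
    (h3 : ∀ x ≤ n, P x → J.lb ≤ x) {t : ℕ} (ht : t ≤ n) :
    ((¬ P t ∧ t ≠ 0 ∧ P (t - 1)) ∧ ∀ x < t, ¬ (¬ P x ∧ x ≠ 0 ∧ P (x - 1))) ↔ t = J.ub + 1 := by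
  have hle := J.le
  constructor
  · rintro ⟨⟨h4, h5, h6⟩, h7⟩
    have h8 := h3 _ (by omega) h6
    have h9 : J.ub < t := by
      by_contra! h
      exact h4 (h1 t (by omega) h)
    by_contra hne
    refine h7 (J.ub + 1) (by omega) ⟨?_, by omega, h1 _ (by simpa using hle) (by simp)⟩
    exact h2.resolve_left (by omega)
  · rintro rfl
    refine ⟨⟨h2.resolve_left (by omega), by omega, h1 _ (by simpa using hle) (by simp)⟩, ?_⟩
    rintro x hx ⟨h4, h5, h6⟩
    have := h3 _ (by omega) h6
    exact h4 (h1 x (by omega) (by omega))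

theorem isDelimited_scopeSem (s : Scope AP) :
    IsDelimited (Sat entails ρ s.left) (s.rightSat entails ρ) ρ.last
      (scopeSem entails ρ s).toList := by
  have hftp : ∀ t, Sat entails ρ ftp t → ¬ Sat entails ρ ftp (t + 1) := by
    intro t _ h
    simp [sat_ftp] at h
  have hffim : ∀ mode t, Sat entails ρ (ffim mode) t → ¬ Sat entails ρ (ffim mode) (t + 1) := by
    intro mode t h h'
    exact (sat_ffim.mp h').2 t (by omega) (sat_ffim.mp h).1
  have hflim : ∀ mode t, Sat entails ρ (flim mode) t → ¬ Sat entails ρ (flim mode) (t + 1) := by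
    intro mode t h h'
    exact (sat_flim.mp h').2 t (by omega) (sat_flim.mp h).1
  have hcompl : ∀ mode, IsDelimited (Sat entails ρ (fnim mode)) (Sat entails ρ (lnim mode)) ρ.last
      ((boolSem entails ρ mode).compl ρ.last).toList := by
    intro mode
    refine (isDelimited_runs (fun t => ¬ Sat entails ρ mode.toMTL t) ρ.last _ ?_).congr ?_ ?_
    · intro I
      have hle := I.le
      rw [OLI.compl, OLI.mem_toList_ofPred]
      simp only [mem_boolSem]
      -- Membership in `boolSem` also carries the bound `x ≤ ρ.last`. This could matter only at
      -- `I.ub + 1` when `I.ub = ρ.last`, where the first disjunct already holds.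
      refine and_congr_right fun hu => and_congr ?_ (and_congr ?_ ?_)
      · exact forall_congr' fun x => forall_congr' fun _ => forall_congr' fun hx => by
          simp [hx.trans hu]
      · simp [show I.lb - 1 ≤ ρ.last by omega]
      · by_cases h : I.ub = ρ.last
        · simp [h]
        · simp [show I.ub + 1 ≤ ρ.last by omega]
    · intro t
      rw [sat_fnim]
      simp only [not_not]
    · intro t
      simp only [lnim, Sat, not_not]
  have hE : ∀ {φ : MTL AP} (s : Scope AP), s.right = some φ → ∀ t,
      s.rightSat entails ρ t ↔ Sat entails ρ φ t := by
    intro φ s h t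
    simp [Scope.rightSat, h]
  have hN : ∀ (s : Scope AP), s.right = none → ∀ t, ¬ s.rightSat entails ρ t := by
    intro s h t
    simp [Scope.rightSat, h]
  cases s with
  | global =>
    refine isDelimited_singleton (I := ⟨0, ρ.last, Nat.zero_le _⟩) le_rfl ?_ ?_ hftp
    · intro t _
      exact sat_ftp
    · intro t ht
      simp only [hN .global rfl t, false_iff]
      omega
  | inMode mode =>
    refine (isDelimited_runs (Sat entails ρ mode.toMTL) ρ.last _ ?_).congr ?_
      (hE (φ := lim mode) (.inMode mode) rfl)
    · intro I
      exact OLI.mem_toList_ofPred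
    · intro t
      exact sat_fim
  | notIn mode => exact (hcompl mode).congr (fun _ => Iff.rfl) (hE _ rfl)
  | onlyIn mode => exact (hcompl mode).congr (fun _ => Iff.rfl) (hE _ rfl)
  | before mode =>
    refine IsDelimited.congr (L := Sat entails ρ ftp) ?_ (fun _ => Iff.rfl) (hE _ rfl)
    simp only [scopeSem, boolSem]
    split
    · next h =>
      have hno := fun x hx => OLI.not_of_toList_ofPred_eq_nil h (x := x) hx
      refine isDelimited_singleton (I := ⟨0, ρ.last, Nat.zero_le _⟩) le_rfl
        (fun _ _ => sat_ftp) ?_ hftp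
      intro t ht
      simp only [sat_ffim, hno t ht, false_and, false_iff]
      omega
    · next J l h =>
      have hJ := OLI.mem_toList_ofPred.mp (h ▸ List.mem_cons_self : J ∈ _)
      have hfst := fun x hx hP => OLI.lb_le_of_toList_ofPred_eq_cons h (x := x) hx hP
      have hle := J.le
      have hiff : ∀ t ≤ ρ.last, Sat entails ρ (ffim mode) t ↔ t = J.lb := by
        intro t ht
        rw [sat_ffim]
        constructor
        · rintro ⟨h1, h2⟩
          have h3 := hfst t ht h1
          by_contra hne
          exact h2 J.lb (by omega) (hJ.2.1 _ le_rfl hle)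
        · rintro rfl
          refine ⟨hJ.2.1 _ le_rfl hle, fun x hx hP => ?_⟩
          have := hfst x (by omega) hP
          omega
      split
      · next h0 =>
        -- The mode holds at time `0`: both endpoints hold there and nowhere else on the trace.
        refine isDelimited_nil ?_ ?_ hftp
        · intro t ht ht0
          rw [hiff t ht]
          omega
        · intro t ht
          rw [hiff t ht, sat_ftp]
          omega
      · next h0 =>
        rw [segment, dif_pos (Nat.zero_le _)]
        refine isDelimited_singleton (by change J.lb - 1 ≤ _; omega) (fun _ _ => sat_ftp) ?_ hftp
        intro t ht
        rw [hiff t ht]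
        change _ ↔ t = J.lb - 1 + 1
        omega
  | after mode =>
    simp only [scopeSem, boolSem]
    split
    · next h =>
      have hno := fun x hx => OLI.not_of_toList_ofPred_eq_nil h (x := x) hx
      refine isDelimited_nil (fun t _ _ => hN _ rfl t) ?_ (hflim mode)
      intro t ht hf
      exact (hno (t - 1) (by omega) (sat_flim.mp hf).1.2.2).elim
    · next J l h =>
      have hJ := OLI.mem_toList_ofPred.mp (h ▸ List.mem_cons_self : J ∈ _)
      have hfst := fun x hx hP => OLI.lb_le_of_toList_ofPred_eq_cons h (x := x) hx hP
      have hiff : ∀ t ≤ ρ.last, Sat entails ρ (flim mode) t ↔ t = J.ub + 1 := by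
        intro t ht
        rw [sat_flim]
        exact not_lim_of_first_run hJ.2.1 hJ.2.2.2 hfst ht
      rw [segment]
      split
      · refine isDelimited_singleton le_rfl hiff ?_ (hflim mode)
        intro t ht
        simp only [hN (.after mode) rfl t, false_iff]
        change t ≠ ρ.last + 1
        omega
      -- The first mode interval reaches the end of the trace, so the left endpoint would have to
      -- lie beyond it.
      · refine isDelimited_nil (fun t _ _ => hN _ rfl t) ?_ (hflim mode)
        intro t ht hf
        have := (hiff t ht).mp hf
        omega
  | onlyAfter mode =>
    refine IsDelimited.congr (L := Sat entails ρ ftp) ?_ (fun _ => Iff.rfl) (hE _ rfl)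
    simp only [scopeSem, boolSem]
    split
    · next h =>
      have hno := fun x hx => OLI.not_of_toList_ofPred_eq_nil h (x := x) hx
      refine isDelimited_singleton (I := ⟨0, ρ.last, Nat.zero_le _⟩) le_rfl
        (fun _ _ => sat_ftp) ?_ hftp
      intro t ht
      simp only [sat_flim, sat_lim, hno (t - 1) (by omega), and_false, false_and, false_iff]
      omega
    · next J l h =>
      have hJ := OLI.mem_toList_ofPred.mp (h ▸ List.mem_cons_self : J ∈ _)
      have hfst := fun x hx hP => OLI.lb_le_of_toList_ofPred_eq_cons h (x := x) hx hP
      rw [segment, dif_pos (Nat.zero_le _)]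
      refine isDelimited_singleton hJ.1 (fun _ _ => sat_ftp) ?_ hftp
      intro t ht
      rw [sat_flim]
      exact not_lim_of_first_run hJ.2.1 hJ.2.2.2 hfst ht
  | onlyBefore mode =>
    simp only [scopeSem, boolSem]
    split
    · next h =>
      have hno := fun x hx => OLI.not_of_toList_ofPred_eq_nil h (x := x) hx
      refine isDelimited_nil (fun t _ _ => hN _ rfl t) ?_ (hffim mode)
      intro t ht hf
      exact (hno t ht (sat_ffim.mp hf).1).elim
    · next J l h =>
      have hJ := OLI.mem_toList_ofPred.mp (h ▸ List.mem_cons_self : J ∈ _)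
      have hfst := fun x hx hP => OLI.lb_le_of_toList_ofPred_eq_cons h (x := x) hx hP
      have hle := J.le
      rw [segment, dif_pos (by omega)]
      refine isDelimited_singleton le_rfl ?_ ?_ (hffim mode)
      · intro t ht
        rw [Scope.left, sat_ffim]
        change _ ↔ t = J.lb
        constructor
        · rintro ⟨h1, h2⟩
          have h3 := hfst t ht h1
          by_contra hne
          exact h2 J.lb (by omega) (hJ.2.1 _ le_rfl hle)
        · rintro rfl
          refine ⟨hJ.2.1 _ le_rfl hle, fun x hx hP => ?_⟩
          have := hfst x (by omega) hP
          omega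
      · intro t ht
        simp only [hN (.onlyBefore mode) rfl t, false_iff]
        change t ≠ ρ.last + 1
        omega

/-! ### Derived past operators and their meaning inside a scope interval -/

theorem sat_sir {φ ψ : MTL AP} {t : ℕ} : Sat entails ρ (.sir φ ψ) t ↔
    ∃ t₀ ≤ t, Sat entails ρ ψ t₀ ∧ ∀ x, t₀ ≤ x → x ≤ t → Sat entails ρ φ x := by
  simp only [MTL.sir, Sat, InBound, true_and]
  refine exists_congr fun t₀ => and_congr_right fun h => ?_
  constructor
  · rintro ⟨⟨h1, h2⟩, h3⟩
    refine ⟨h2, fun x hx hxt => ?_⟩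
    rcases hx.eq_or_lt with rfl | hx
    · exact h1
    · exact h3 x hx hxt
  · rintro ⟨h1, h2⟩
    exact ⟨⟨h2 _ le_rfl h, h1⟩, fun x hx hxt => h2 x hx.le hxt⟩

theorem sat_sio {φ ψ : MTL AP} {t : ℕ} : Sat entails ρ (.sio φ ψ) t ↔
    (Sat entails ρ (.once none ψ) t → Sat entails ρ (.sir φ ψ) t) := imp_iff_not_or.symm

theorem sat_once {φ : MTL AP} {t : ℕ} : Sat entails ρ (.once none φ) t ↔
    ∃ t₀ ≤ t, Sat entails ρ φ t₀ := by
  simp [Sat, InBound]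

theorem sat_onceUpTo {d : ℕ} {φ : MTL AP} {t : ℕ} : Sat entails ρ (.onceUpTo d φ) t ↔
    ∃ t₀ ≤ t, t ≤ t₀ + d ∧ Sat entails ρ φ t₀ := by
  simp only [MTL.onceUpTo, Sat, InBound]
  refine exists_congr fun t₀ => and_congr_right fun h => and_congr_left fun _ => ?_
  constructor
  · rintro ⟨-, h⟩
    simp only at h
    omega
  · intro h
    exact ⟨Nat.zero_le _, by simp only; omega⟩

/-- The strict inequality covers `d = 0` uniformly, where `t₀ ≤ t < t₀` is impossible. -/
theorem sat_onceBelow {d : ℕ} {φ : MTL AP} {t : ℕ} : Sat entails ρ (.onceBelow d φ) t ↔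
    ∃ t₀ ≤ t, t < t₀ + d ∧ Sat entails ρ φ t₀ := by
  cases d with
  | zero =>
    simp only [MTL.onceBelow, Sat, false_iff]
    rintro ⟨t₀, h1, h2, -⟩
    omega
  | succ d =>
    rw [MTL.onceBelow, sat_onceUpTo]
    refine exists_congr fun t₀ => and_congr_right fun h => and_congr_left fun _ => ?_
    omega

theorem sat_prevN {d : ℕ} {φ : MTL AP} {t : ℕ} : Sat entails ρ (.prevN d φ) t ↔
    ∃ t₀, t₀ + d = t ∧ Sat entails ρ φ t₀ := by
  simp only [MTL.prevN, Sat, InBound, ← and_assoc]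
  refine exists_congr fun t₀ => and_congr_left fun _ => ?_
  constructor
  · rintro ⟨h0, h1, h2⟩
    simp only at h1 h2
    omega
  · intro h
    exact ⟨by omega, by simp only; omega, by simp only; omega⟩

/-- Within `[l, u]` the left endpoint `L` holds exactly at `l`, and it does not hold at `l - 1`. -/
structure IsLeftOn (L : ℕ → Prop) (I : NatInterval) : Prop where
  iff_eq : ∀ j, I.lb ≤ j → j ≤ I.ub → (L j ↔ j = I.lb)
  not_pred : I.lb ≠ 0 → ¬ L (I.lb - 1)

theorem IsLeftOn.lb {L : ℕ → Prop} {I : NatInterval} (h : IsLeftOn L I) : L I.lb :=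
  (h.iff_eq _ le_rfl I.le).mpr rfl

/-- As the left endpoint does not recur after `I.lb`, any witness lies at or before `I.lb`; an
earlier one only makes `φ` hold on a longer stretch. -/
theorem IsLeftOn.sir_iff {left φ : MTL AP} {I : NatInterval} (h : IsLeftOn (Sat entails ρ left) I)
    {j : ℕ} (hj : I.lb ≤ j) (hju : j ≤ I.ub) :
    Sat entails ρ (.sir φ left) j ↔ ∀ x, I.lb ≤ x → x ≤ j → Sat entails ρ φ x := by
  rw [sat_sir]
  constructor
  · rintro ⟨t₀, h1, h2, h3⟩ x hx hxj
    refine h3 x ?_ hxj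
    by_contra! hlt
    have := (h.iff_eq t₀ (by omega) (by omega)).mp h2
    omega
  · intro h'
    exact ⟨I.lb, hj, h.lb, h'⟩

theorem IsLeftOn.once_left {left : MTL AP} {I : NatInterval}
    (h : IsLeftOn (Sat entails ρ left) I) : Sat entails ρ (.once none left) I.ub :=
  sat_once.mpr ⟨I.lb, I.le, h.lb⟩

theorem IsLeftOn.sio_iff {left φ : MTL AP} {I : NatInterval}
    (h : IsLeftOn (Sat entails ρ left) I) :
    Sat entails ρ (.sio φ left) I.ub ↔ ∀ x, I.lb ≤ x → x ≤ I.ub → Sat entails ρ φ x := by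
  rw [sat_sio, h.sir_iff I.le le_rfl]
  exact ⟨fun h' => h' h.once_left, fun h' _ => h'⟩

theorem IsLeftOn.onceUpTo_iff {left : MTL AP} {I : NatInterval}
    (h : IsLeftOn (Sat entails ρ left) I) {d j : ℕ} (hj : I.lb ≤ j) (hju : j ≤ I.ub) :
    Sat entails ρ (.onceUpTo d left) j ↔ j ≤ I.lb + d := by
  rw [sat_onceUpTo]
  constructor
  · rintro ⟨t₀, h1, h2, h3⟩
    by_contra! hlt
    have := (h.iff_eq t₀ (by omega) (by omega)).mp h3
    omega
  · intro h'
    exact ⟨I.lb, hj, h', h.lb⟩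

theorem IsLeftOn.onceBelow_iff {left : MTL AP} {I : NatInterval}
    (h : IsLeftOn (Sat entails ρ left) I) {d j : ℕ} (hj : I.lb ≤ j) (hju : j ≤ I.ub) :
    Sat entails ρ (.onceBelow d left) j ↔ j < I.lb + d := by
  rw [sat_onceBelow]
  constructor
  · rintro ⟨t₀, h1, h2, h3⟩
    by_contra! hlt
    have := (h.iff_eq t₀ (by omega) (by omega)).mp h3
    omega
  · intro h'
    exact ⟨I.lb, hj, h', h.lb⟩

/-! ### Semantics of timings, in terms of satisfaction at time points -/

/-- Since `t` is not before `I.lb`, a stop from `t` on belongs to `I` as soon as it is at most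
`I.ub`. This comparison, with the bound `firstStop_le`, replaces the infimum in all later reasoning.
-/
theorem lt_firstStop {stopExpr : BExpr AP} {I : NatInterval} (hI : I.ub ≤ ρ.last) {t x : ℕ}
    (ht : I.lb ≤ t) : x < firstStop entails ρ stopExpr t I ↔
      x ≤ I.ub ∧ ∀ s, t ≤ s → s ≤ x → ¬ Sat entails ρ stopExpr.toMTL s := by
  have hmem : ∀ s, t ≤ s → (s ∈ stops entails ρ stopExpr I ↔
      s ≤ I.ub ∧ Sat entails ρ stopExpr.toMTL s) := by
    intro s hs
    change (I.lb ≤ s ∧ s ≤ I.ub) ∧ s ∈ boolSem entails ρ stopExpr ↔ _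
    rw [mem_boolSem]
    constructor
    · rintro ⟨⟨-, h1⟩, -, h2⟩
      exact ⟨h1, h2⟩
    · rintro ⟨h1, h2⟩
      exact ⟨⟨by omega, h1⟩, by omega, h2⟩
  rw [firstStop]
  split
  · next h =>
    obtain ⟨s, hs, hts⟩ := h
    have hinf := Nat.sInf_mem (s := {s | s ∈ stops entails ρ stopExpr I ∧ t ≤ s}) ⟨s, hs, hts⟩
    have hinf' := (hmem _ hinf.2).mp hinf.1
    constructor
    · intro hx
      refine ⟨by omega, fun y hy hyx hSat => ?_⟩
      exact Nat.notMem_of_lt_sInf (lt_of_le_of_lt hyx hx) ⟨(hmem y hy).mpr ⟨by omega, hSat⟩, hy⟩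
    · rintro ⟨-, h2⟩
      by_contra! hle
      exact h2 _ hinf.2 hle hinf'.2
  · next h =>
    push Not at h
    constructor
    · intro hx
      refine ⟨by omega, fun y hy hyx hSat => ?_⟩
      have := h y ((hmem y hy).mpr ⟨by omega, hSat⟩)
      omega
    · intro h'
      omega

theorem firstStop_le {stopExpr : BExpr AP} {I : NatInterval} {t : ℕ} :
    firstStop entails ρ stopExpr t I ≤ I.ub + 1 := by
  rw [firstStop]
  split
  · next h =>
    obtain ⟨s, hs, hts⟩ := h
    have := Nat.sInf_mem (s := {s | s ∈ stops entails ρ stopExpr I ∧ t ≤ s}) ⟨s, hs, hts⟩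
    exact this.1.1.2.trans (Nat.le_succ _)
  · exact le_rfl

theorem triggers_subset {cond : Option (BExpr AP)} {I : NatInterval} {t : ℕ}
    (ht : t ∈ triggers entails ρ cond I) : I.lb ≤ t ∧ t ≤ I.ub := by
  cases cond with
  | none =>
    obtain rfl : t = I.lb := ht
    exact ⟨le_rfl, I.le⟩
  | some c =>
    obtain ⟨J, -, ⟨x, ⟨h1, h2⟩, h3, h4⟩, rfl⟩ := ht
    have := I.le
    omega

/-- A run of the condition that starts before `I` and meets it triggers at `I.lb`; one that starts
inside triggers where the condition switches on. This is the shape of `triggerFormula`. -/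
theorem mem_triggers_some {c : BExpr AP} {I : NatInterval} (hI : I.ub ≤ ρ.last) {t : ℕ} :
    t ∈ triggers entails ρ (some c) I ↔ (I.lb ≤ t ∧ t ≤ I.ub) ∧ Sat entails ρ c.toMTL t ∧
      (t = I.lb ∨ ¬ Sat entails ρ c.toMTL (t - 1)) := by
  constructor
  · intro ht
    refine ⟨triggers_subset ht, ?_⟩
    obtain ⟨J, hJ, ⟨x, ⟨h1, h2⟩, h3, h4⟩, rfl⟩ := ht
    obtain ⟨h5, h6, h7, -⟩ := OLI.mem_toList_ofPred.mp hJ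
    refine ⟨h6 _ (le_max_left _ _) (by omega), ?_⟩
    by_cases hle : J.lb ≤ I.lb
    · exact Or.inl (max_eq_right hle)
    · rw [max_eq_left (by omega)]
      exact Or.inr (h7.resolve_left (by omega))
  · rintro ⟨⟨h1, h2⟩, h3, h4⟩
    obtain ⟨J, hJ, hJt⟩ := (mem_boolSem entails ρ).mpr ⟨h2.trans hI, h3⟩
    refine ⟨J, hJ, ⟨t, hJt, h1, h2⟩, ?_⟩
    obtain ⟨-, h6, -, -⟩ := OLI.mem_toList_ofPred.mp hJ
    have h7 := hJt.1
    have h8 := hJt.2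
    rcases h4 with h4 | h4
    · omega
    · by_contra hne
      exact h4 (h6 _ (by omega) (by omega))

/-- The first point from `I.lb` on at which the condition holds is a trigger. This is why
`noTriggersFormula` expresses the absence of triggers so far. -/
theorem exists_trigger {c : BExpr AP} {I : NatInterval} (hI : I.ub ≤ ρ.last) {j : ℕ}
    (hj : j ≤ I.ub) : (∃ x, I.lb ≤ x ∧ x ≤ j ∧ Sat entails ρ c.toMTL x) ↔
      ∃ t ∈ triggers entails ρ (some c) I, t ≤ j := by
  constructor
  · rintro ⟨x, hx, hxj, hSat⟩
    obtain ⟨y, h1, h2, h3, h4⟩ := exists_first (P := Sat entails ρ c.toMTL) hx hSat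
    refine ⟨y, (mem_triggers_some hI).mpr ⟨⟨h1, by omega⟩, h3, ?_⟩, by omega⟩
    by_cases h : y = I.lb
    · exact Or.inl h
    · exact Or.inr (h4 _ (by omega) (by omega))
  · rintro ⟨t, ht, htj⟩
    obtain ⟨⟨h1, -⟩, h2, -⟩ := (mem_triggers_some hI).mp ht
    exact ⟨t, h1, htj, h2⟩

/-- The denotational semantics of a timing, with the lists of intervals of the response and of the
stop condition eliminated. -/
def Holds (entails : Set AP → AP → Prop) (ρ : Trace AP) (T : Set ℕ) (u : ℕ) (res : BExpr AP) :
    BasicTiming AP → Prop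
  | .immediately => ∀ t ∈ T, Sat entails ρ res.toMTL t
  | .next => ∀ t ∈ T, t + 1 ≤ u → Sat entails ρ res.toMTL (t + 1)
  | .always => ∀ t ∈ T, ∀ j, t ≤ j → j ≤ u → Sat entails ρ res.toMTL j
  | .eventually => ∀ t ∈ T, ∃ j, t ≤ j ∧ j ≤ u ∧ Sat entails ρ res.toMTL j
  | .within d => ∀ t ∈ T, t + d ≤ u → ∃ j, t ≤ j ∧ j ≤ t + d ∧ Sat entails ρ res.toMTL j
  | .for d => ∀ t ∈ T, ∀ j, t ≤ j → j ≤ t + d → j ≤ u → Sat entails ρ res.toMTL j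
  | .until stopExpr => ∀ t ∈ T, ∀ j, t ≤ j → j ≤ u →
      (∀ s, t ≤ s → s ≤ j → ¬ Sat entails ρ stopExpr.toMTL s) → Sat entails ρ res.toMTL j
  | .before stopExpr => ∀ t ∈ T, ∀ s, t ≤ s → s ≤ u → Sat entails ρ stopExpr.toMTL s →
      ∃ j, t ≤ j ∧ j < s ∧ Sat entails ρ res.toMTL j

theorem exists_isLeast_triggers {cond : Option (BExpr AP)} {I : NatInterval}
    (h : (triggers entails ρ cond I).Nonempty) : ∃ m, IsLeast (triggers entails ρ cond I) m :=
  ⟨_, Nat.sInf_mem h, fun _ => Nat.sInf_le⟩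

theorem exists_isGreatest_triggers {cond : Option (BExpr AP)} {I : NatInterval}
    (h : (triggers entails ρ cond I).Nonempty) :
    ∃ m, IsGreatest (triggers entails ρ cond I) m :=
  ⟨_, Nat.sSup_mem h ⟨I.ub, fun _ hx => (triggers_subset hx).2⟩,
    fun _ hx => le_csSup ⟨I.ub, fun _ hx => (triggers_subset hx).2⟩ hx⟩

/-- Quantifying over all triggers absorbs the case of an empty trigger set. The least trigger
imposes the strongest `always`, the greatest the strongest `eventually`, so these two timings are
universal as well. -/
theorem mem_timeSem {cond : Option (BExpr AP)} {res : BExpr AP} {τ : BasicTiming AP}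
    {I : NatInterval} (hI : I.ub ≤ ρ.last) : I ∈ timeSem entails ρ cond res τ ↔
      Holds entails ρ (triggers entails ρ cond I) I.ub res τ := by
  have hsub := fun t ht => triggers_subset (entails := entails) (ρ := ρ) (cond := cond) (I := I)
    (t := t) ht
  have hR : ∀ j ≤ I.ub, (j ∈ boolSem entails ρ res ↔ Sat entails ρ res.toMTL j) := by
    intro j hj
    rw [mem_boolSem, and_iff_right (hj.trans hI)]
  have hmemI : ∀ x, x ∈ I ↔ I.lb ≤ x ∧ x ≤ I.ub := fun _ => Iff.rfl
  have hleast := exists_isLeast_triggers (entails := entails) (ρ := ρ) (cond := cond) (I := I)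
  have hgreat := exists_isGreatest_triggers (entails := entails) (ρ := ρ) (cond := cond) (I := I)
  have hlt := fun (stopExpr : BExpr AP) t (ht : t ∈ triggers entails ρ cond I) x =>
    lt_firstStop (entails := entails) (ρ := ρ) (stopExpr := stopExpr) hI (t := t) (x := x)
      (hsub t ht).1
  have hstops : ∀ (stopExpr : BExpr AP) s, s ∈ stops entails ρ stopExpr I ↔
      (I.lb ≤ s ∧ s ≤ I.ub) ∧ Sat entails ρ stopExpr.toMTL s := by
    intro stopExpr s
    change (I.lb ≤ s ∧ s ≤ I.ub) ∧ s ∈ boolSem entails ρ stopExpr ↔ _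
    refine and_congr_right fun h => ?_
    rw [mem_boolSem, and_iff_right (h.2.trans hI)]
  rcases (triggers entails ρ cond I).eq_empty_or_nonempty with hT | hT
  · cases τ <;> simp [timeSem, Holds, hT]
  have hne := hT.ne_empty
  replace hleast := hleast hT
  replace hgreat := hgreat hT
  rcases τ with _ | _ | _ | _ | d | d | stopExpr | stopExpr
  · simp only [timeSem, Holds, Set.mem_union, Set.mem_ofPred_eq, hne, hT, false_or, true_and]
    exact forall₂_congr fun t ht => hR t (hsub t ht).2
  · simp only [timeSem, Holds, Set.mem_union, Set.mem_ofPred_eq, hne, hT, false_or, true_and, hmemI]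
    refine forall₂_congr fun t ht => ?_
    have := hsub t ht
    exact ⟨fun h h1 => (hR _ h1).mp (h ⟨by omega, h1⟩), fun h h1 => (hR _ h1.2).mpr (h h1.2)⟩
  · simp only [timeSem, Holds, Set.mem_union, Set.mem_ofPred_eq, hne, hT, false_or, true_and]
    constructor
    · rintro ⟨m, hm, h⟩ t ht j hj hju
      exact (hR j hju).mp (h j ((hm.2 ht).trans hj) hju)
    · intro h
      obtain ⟨m, hm⟩ := hleast
      exact ⟨m, hm, fun j hj hju => (hR j hju).mpr (h m hm.1 j hj hju)⟩
  · simp only [timeSem, Holds, Set.mem_union, Set.mem_ofPred_eq, hne, hT, false_or, true_and]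
    constructor
    · rintro ⟨m, hm, j, hj, hju, h⟩ t ht
      exact ⟨j, (hm.2 ht).trans hj, hju, (hR j hju).mp h⟩
    · intro h
      obtain ⟨m, hm⟩ := hgreat
      obtain ⟨j, hj, hju, h⟩ := h m hm.1
      exact ⟨m, hm, j, hj, hju, (hR j hju).mpr h⟩
  · simp only [timeSem, Holds, Set.mem_union, Set.mem_ofPred_eq, hne, hT, false_or, true_and, hmemI]
    refine forall₂_congr fun t ht => ?_
    have := hsub t ht
    constructor
    · intro h h1
      obtain ⟨k, hk, h2, h3⟩ := h ⟨by omega, h1⟩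
      exact ⟨t + k, by omega, by omega, (hR _ h2.2).mp h3⟩
    · intro h h1
      obtain ⟨j, h2, h3, h4⟩ := h h1.2
      obtain ⟨k, rfl⟩ := Nat.exists_eq_add_of_le h2
      exact ⟨k, by omega, by omega, (hR _ (by omega)).mpr h4⟩
  · simp only [timeSem, Holds, Set.mem_union, Set.mem_ofPred_eq, hne, hT, false_or, true_and, hmemI]
    refine forall₂_congr fun t ht => ?_
    have := hsub t ht
    constructor
    · intro h j h1 h2 h3
      obtain ⟨k, rfl⟩ := Nat.exists_eq_add_of_le h1
      exact (hR _ h3).mp (h k (by omega) ⟨by omega, h3⟩)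
    · intro h k hk h1
      exact (hR _ h1.2).mpr (h _ (by omega) (by omega) h1.2)
  · simp only [timeSem, Holds, Set.mem_union, Set.mem_ofPred_eq, hne, hT, false_or, true_and]
    refine forall₂_congr fun t ht => forall₂_congr fun x hx => ?_
    rw [hlt stopExpr t ht x]
    constructor
    · intro h h1 h2
      exact (hR x h1).mp (h ⟨h1, h2⟩)
    · rintro h ⟨h1, h2⟩
      exact (hR x h1).mpr (h h1 h2)
  · simp only [timeSem, Holds, Set.mem_union, Set.mem_ofPred_eq, hne, hT, false_or, true_and]
    constructor
    · rintro (h | ⟨-, h⟩) t ht s hts hsu hs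
      · exact (Set.eq_empty_iff_forall_notMem.mp h s
          ((hstops stopExpr s).mpr ⟨⟨(hsub t ht).1.trans hts, hsu⟩, hs⟩)).elim
      · rcases h t ht with h | ⟨x, hx, hlt', hSat⟩
        · exact (((hlt stopExpr t ht s).mp (by omega)).2 s hts le_rfl hs).elim
        · obtain ⟨h1, h2⟩ := (hlt stopExpr t ht x).mp hlt'
          refine ⟨x, hx, ?_, (hR x h1).mp hSat⟩
          by_contra! hle
          exact h2 s hts hle hs
    · intro h
      by_cases hS : stops entails ρ stopExpr I = ∅
      · exact Or.inl hS
      refine Or.inr ⟨Set.nonempty_iff_ne_empty.mpr hS, fun t ht => ?_⟩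
      by_cases hex : ∃ s, t ≤ s ∧ s ≤ I.ub ∧ Sat entails ρ stopExpr.toMTL s
      · obtain ⟨s, hts, hsu, hs⟩ := hex
        -- A response before an arbitrary stop `s` need not precede `firstStop`; hence the
        -- hypothesis is applied to the first stop `s'` after `t`.
        obtain ⟨s', h1, h2, h3, h4⟩ := exists_first (P := Sat entails ρ stopExpr.toMTL) hts hs
        obtain ⟨j, hj, hjs, hSat⟩ := h t ht s' h1 (by omega) h3
        exact Or.inr ⟨j, hj, (hlt stopExpr t ht j).mpr
          ⟨by omega, fun x hx hxj => h4 x hx (by omega)⟩, (hR j (by omega)).mpr hSat⟩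
      · left
        refine le_antisymm firstStop_le ((hlt stopExpr t ht I.ub).mpr
          ⟨le_rfl, fun s h1 h2 h3 => hex ⟨s, h1, h2, h3⟩⟩)

/-! ### Core formulas within a scope interval -/

theorem sat_triggerFormula {c : BExpr AP} {left : MTL AP} {I : NatInterval}
    (hI : I.ub ≤ ρ.last) (h : IsLeftOn (Sat entails ρ left) I) {t : ℕ} (ht : I.lb ≤ t)
    (htu : t ≤ I.ub) : Sat entails ρ (triggerFormula c left) t ↔
      t ∈ triggers entails ρ (some c) I := by
  rw [mem_triggers_some hI]
  simp only [triggerFormula, Sat, h.iff_eq t ht htu]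
  constructor
  · rintro (⟨h1, h2, h3⟩ | ⟨h1, h2⟩)
    · exact ⟨⟨ht, htu⟩, h1, Or.inr h3⟩
    · exact ⟨⟨ht, htu⟩, h1, Or.inl h2⟩
  · rintro ⟨-, h1, h2⟩
    by_cases h0 : t = I.lb
    · exact Or.inr ⟨h1, h0⟩
    · exact Or.inl ⟨h1, by omega, h2.resolve_left h0⟩

theorem sat_noTriggersFormula {c : BExpr AP} {left : MTL AP} {I : NatInterval}
    (hI : I.ub ≤ ρ.last) (h : IsLeftOn (Sat entails ρ left) I) {t : ℕ} (ht : I.lb ≤ t)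
    (htu : t ≤ I.ub) : Sat entails ρ (noTriggersFormula c left) t ↔
      ∀ s ∈ triggers entails ρ (some c) I, t < s := by
  rw [noTriggersFormula, h.sir_iff ht htu]
  have := not_congr (exists_trigger (entails := entails) (c := c) hI htu)
  push Not at this
  exact this

/-- The only trigger is `I.lb`, so each timing is tested point by point against the distance from
the left endpoint. -/
theorem holds_iff_coreFormulaNull {res : BExpr AP} {τ : BasicTiming AP} {left : MTL AP}
    {I : NatInterval} (h : IsLeftOn (Sat entails ρ left) I) (hτ : τ ≠ .eventually) :
    Holds entails ρ {I.lb} I.ub res τ ↔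
      ∀ j, I.lb ≤ j → j ≤ I.ub → Sat entails ρ (coreFormulaNull res left τ) j := by
  have hle := I.le
  have hL := h.iff_eq
  simp only [Holds.eq_def, Set.mem_singleton_iff, forall_eq]
  rcases τ with _ | _ | _ | _ | d | d | stopExpr | stopExpr
  · simp only [coreFormulaNull, Sat, ← imp_iff_not_or]
    constructor
    · intro h1 j hj hju hLj
      obtain rfl := (hL j hj hju).mp hLj
      exact h1
    · intro h1
      exact h1 _ le_rfl hle h.lb
  · simp only [coreFormulaNull, Sat, ← imp_iff_not_or]
    constructor
    · rintro h1 j hj hju ⟨h0, h2⟩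
      rcases hj.eq_or_lt with rfl | hj
      -- At `j = I.lb` the premise would require a left endpoint just before the interval, which
      -- `not_pred` excludes; the formula would otherwise demand the response at `I.lb`.
      · exact (h.not_pred h0 h2).elim
      · have := (hL (j - 1) (by omega) (by omega)).mp h2
        obtain rfl : j = I.lb + 1 := by omega
        exact h1 hju
    · intro h1 h2
      exact h1 _ (by omega) h2 ⟨by omega, h.lb⟩
  · rfl
  · exact (hτ rfl).elim
  · simp only [coreFormulaNull, Sat, ← imp_iff_not_or]
    constructor
    · intro h1 j hj hju h2
      rw [h.sir_iff hj hju] at h2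
      rw [h.onceBelow_iff hj hju]
      by_contra! hlt
      obtain ⟨x, h3, h4, h5⟩ := h1 (by omega)
      exact h2 x h3 (by omega) h5
    · intro h1 h2
      by_contra! h3
      -- The deadline `I.lb + d` is the first point at which the window of length `d` no longer
      -- reaches the left endpoint.
      have h4 := h1 (I.lb + d) (by omega) h2 ((h.sir_iff (by omega) h2).mpr h3)
      rw [h.onceBelow_iff (by omega) h2] at h4
      omega
  · simp only [coreFormulaNull, Sat, ← imp_iff_not_or]
    refine forall₂_congr fun j hj => ?_
    constructor
    · intro h1 hju h2
      exact h1 ((h.onceUpTo_iff hj hju).mp h2) hju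
    · intro h1 h2 hju
      exact h1 hju ((h.onceUpTo_iff hj hju).mpr h2)
  · simp only [coreFormulaNull, Sat, ← imp_iff_not_or]
    refine forall₂_congr fun j hj => forall_congr' fun hju => ?_
    rw [h.sir_iff hj hju]
    rfl
  · simp only [coreFormulaNull, Sat, ← imp_iff_not_or]
    refine forall₂_congr fun j hj => forall_congr' fun hju => forall_congr' fun _ => ?_
    rw [hL j hj hju]
    constructor
    · rintro ⟨x, h1, h2, h3⟩
      refine ⟨by omega, fun ⟨h4, h5⟩ => ?_⟩
      rw [h.sir_iff (by omega) (by omega)] at h5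
      exact h5 x h1 (by omega) h3
    · rintro ⟨h1, h2⟩
      by_contra! h3
      refine h2 ⟨by omega, (h.sir_iff (by omega) (by omega)).mpr fun x hx hxj => h3 x hx (by omega)⟩

theorem holds_iff_coreFormulaCond {c res : BExpr AP} {τ : BasicTiming AP} {left : MTL AP}
    {I : NatInterval} (hI : I.ub ≤ ρ.last) (h : IsLeftOn (Sat entails ρ left) I)
    (hτ : τ ≠ .eventually) :
    Holds entails ρ (triggers entails ρ (some c) I) I.ub res τ ↔
      ∀ j, I.lb ≤ j → j ≤ I.ub → Sat entails ρ (coreFormulaCond c res left τ) j := by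
  have hle := I.le
  have hL := h.iff_eq
  have hTr := fun t ht htu => sat_triggerFormula (c := c) hI h (t := t) ht htu
  have hNT := fun t ht htu => sat_noTriggersFormula (c := c) hI h (t := t) ht htu
  have hsub : ∀ t ∈ triggers entails ρ (some c) I, I.lb ≤ t ∧ t ≤ I.ub :=
    fun t ht => triggers_subset ht
  have hT : ∀ t ∈ triggers entails ρ (some c) I, Sat entails ρ (triggerFormula c left) t :=
    fun t ht => (hTr t (hsub t ht).1 (hsub t ht).2).mpr ht
  -- From here on the trigger set enters only through its correspondence with the trigger and
  -- no-trigger formulas.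
  generalize triggers entails ρ (some c) I = T at *
  rcases τ with _ | _ | _ | _ | d | d | stopExpr | stopExpr
  · simp only [coreFormulaCond, Sat, ← imp_iff_not_or, Holds]
    constructor
    · intro h1 j hj hju h2
      exact h1 j ((hTr j hj hju).mp h2)
    · intro h1 t ht
      exact h1 t (hsub t ht).1 (hsub t ht).2 (hT t ht)
  · simp only [coreFormulaCond, Sat, ← imp_iff_not_or, Holds]
    constructor
    · rintro h1 j hj hju ⟨h0, h2⟩
      rcases hj.eq_or_lt with rfl | hj
      -- At `I.lb` the preceding trigger lies outside the interval; the disjunct `left` discards it.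
      · exact Or.inr h.lb
      · have h3 := h1 _ ((hTr _ (by omega) (by omega)).mp h2) (by omega)
        rw [show j - 1 + 1 = j by omega] at h3
        exact Or.inl h3
    · intro h1 t ht htu
      have := hsub t ht
      rcases h1 (t + 1) (by omega) htu ⟨by omega, hT t ht⟩ with h2 | h2
      · exact h2
      · have := (hL (t + 1) (by omega) htu).mp h2
        omega
  · simp only [coreFormulaCond, Sat, sat_sir, Holds]
    constructor
    · intro h1 j hj hju
      rw [hNT j hj hju, or_iff_not_imp_left]
      intro h2
      push Not at h2
      obtain ⟨t, ht, htj⟩ := h2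
      exact ⟨t, htj, hT t ht, fun x hx hxj => h1 t ht x hx (by omega)⟩
    · intro h1 t ht j hj hju
      have := hsub t ht
      rcases h1 j (by omega) hju with h2 | ⟨t₀, h2, -, h3⟩
      · have := (hNT j (by omega) hju).mp h2 t ht
        omega
      · exact h3 j h2 le_rfl
  · exact (hτ rfl).elim
  · simp only [coreFormulaCond, Sat, sat_prevN, sat_onceBelow, ← imp_iff_not_or, Holds]
    constructor
    · rintro h1 j hj hju ⟨t₀, rfl, h2, h3⟩
      -- For a trigger before the interval, the window `(t₀, t₀ + d]` contains `I.lb`, so the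
      -- disjunct `left` holds. Otherwise the response occurs strictly after `t₀`, where it is known
      -- to fail.
      rcases Nat.lt_or_ge t₀ I.lb with hlt | hge
      · exact ⟨I.lb, hj, by omega, Or.inl h.lb⟩
      · obtain ⟨x, h4, h5, h6⟩ := h1 t₀ ((hTr t₀ hge (by omega)).mp h2) hju
        have hne : x ≠ t₀ := by
          rintro rfl
          exact h3 h6
        exact ⟨x, h5, by omega, Or.inr h6⟩
    · intro h1 t ht htu
      have h0 := hsub t ht
      by_cases hres : Sat entails ρ res.toMTL t
      · exact ⟨t, le_rfl, by omega, hres⟩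
      obtain ⟨x, h2, h3, h4⟩ := h1 (t + d) (by omega) htu ⟨t, rfl, hT t ht, hres⟩
      refine ⟨x, by omega, h2, h4.resolve_left fun h5 => ?_⟩
      have := (hL x (by omega) (by omega)).mp h5
      omega
  · simp only [coreFormulaCond, Sat, sat_onceUpTo, ← imp_iff_not_or, Holds]
    constructor
    · rintro h1 j hj hju ⟨t₀, h2, h3, h4⟩
      rw [hNT j hj hju, or_iff_not_imp_left]
      intro h5
      push Not at h5
      obtain ⟨t, ht, htj⟩ := h5
      have h0 := hsub t ht
      -- If `t₀` precedes the interval, the trigger `t` inside is later, so `j` is within distance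
      -- `d` of `t` too.
      rcases Nat.lt_or_ge t₀ I.lb with hlt | hge
      · exact h1 t ht j htj (by omega) hju
      · exact h1 t₀ ((hTr t₀ hge (by omega)).mp h4) j h2 h3 hju
    · intro h1 t ht j hj hjd hju
      have h0 := hsub t ht
      refine (h1 j (by omega) hju ⟨t, hj, hjd, hT t ht⟩).resolve_left fun h2 => ?_
      have := (hNT j (by omega) hju).mp h2 t ht
      omega
  · simp only [coreFormulaCond, Sat, sat_sir, ← imp_iff_not_or, Holds]
    constructor
    · intro h1 j hj hju
      rw [hNT j hj hju, or_iff_not_imp_left]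
      intro h2
      push Not at h2
      obtain ⟨t, ht, htj⟩ := h2
      have h0 := hsub t ht
      rintro ⟨t₀, h3, h4, h5⟩
      -- An outside witness `t₀` excludes stops on all of `[t₀, j]`, in particular since the inside
      -- trigger `t`.
      rcases Nat.lt_or_ge t₀ I.lb with hlt | hge
      · exact h1 t ht j htj hju fun s hs hsj => h5 s (by omega) hsj
      · exact h1 t₀ ((hTr t₀ hge (by omega)).mp h4) j h3 hju h5
    · intro h1 t ht j hj hju hs
      have h0 := hsub t ht
      rcases h1 j (by omega) hju with h2 | h2
      · have := (hNT j (by omega) hju).mp h2 t ht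
        omega
      · exact h2 ⟨t, hj, hT t ht, hs⟩
  · simp only [coreFormulaCond, Sat, sat_sir, ← imp_iff_not_or, Holds]
    constructor
    · intro h1 j hj hju hs
      rw [hNT j hj hju, or_iff_not_imp_left, hTr j hj hju, hL j hj hju]
      intro h2
      push Not at h2
      obtain ⟨t, ht, htj⟩ := h2
      have h0 := hsub t ht
      obtain ⟨x, h3, h4, h5⟩ := h1 t ht j htj hju hs
      refine ⟨⟨by omega, fun hjT => ?_⟩, ?_⟩
      -- A stop at a trigger leaves no room for a response strictly before it.
      · obtain ⟨y, h6, h7, -⟩ := h1 j hjT j le_rfl hju hs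
        omega
      · rintro ⟨-, t₀, h6, h7, h8⟩
        rcases Nat.lt_or_ge t₀ I.lb with hlt | hge
        · exact h8 x (by omega) (by omega) h5
        · obtain ⟨y, h9, h10, h11⟩ :=
            h1 t₀ ((hTr t₀ hge (by omega)).mp h7) j (by omega) hju hs
          exact h8 y h9 (by omega) h11
    · intro h1 t ht s hts hsu hs
      have h0 := hsub t ht
      rcases h1 s (by omega) hsu hs with h2 | ⟨⟨-, h2⟩, h3⟩
      · have := (hNT s (by omega) hsu).mp h2 t ht
        omega
      · have hne : s ≠ t := by
          rintro rfl
          exact h2 (hT s ht)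
        by_contra! h4
        exact h3 ⟨by omega, t, by omega, hT t ht, fun x hx hxs => h4 x hx (by omega)⟩

theorem holds_eventually_iff_coreFormulaNull {res : BExpr AP} {left : MTL AP}
    {I : NatInterval} (h : IsLeftOn (Sat entails ρ left) I) :
    Holds entails ρ {I.lb} I.ub res .eventually ↔
      Sat entails ρ (coreFormulaNull res left .eventually) I.ub := by
  simp only [Holds, Set.mem_singleton_iff, forall_eq, coreFormulaNull, Sat, h.sir_iff I.le le_rfl]
  push Not
  rfl

/-- A counterexample is a trigger after which the response fails up to `I.ub`. If the witness `t₀`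
of the `SIR` precedes the interval, the failure also covers everything after any trigger inside. -/
theorem holds_eventually_iff_coreFormulaCond {c res : BExpr AP} {left : MTL AP}
    {I : NatInterval} (hI : I.ub ≤ ρ.last) (h : IsLeftOn (Sat entails ρ left) I) :
    Holds entails ρ (triggers entails ρ (some c) I) I.ub res .eventually ↔
      Sat entails ρ (coreFormulaCond c res left .eventually) I.ub := by
  have hsub : ∀ t ∈ triggers entails ρ (some c) I, I.lb ≤ t ∧ t ≤ I.ub :=
    fun t ht => triggers_subset ht
  simp only [Holds, coreFormulaCond, Sat, sat_sir, sat_noTriggersFormula hI h I.le le_rfl]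
  constructor
  · intro h1
    rw [or_iff_not_imp_left]
    intro h2
    push Not at h2
    obtain ⟨t, ht, -⟩ := h2
    rintro ⟨t₀, h3, h4, h5⟩
    have h0 := hsub t ht
    rcases Nat.lt_or_ge t₀ I.lb with hlt | hge
    · obtain ⟨j, h6, h7, h8⟩ := h1 t ht
      exact h5 j (by omega) h7 h8
    · obtain ⟨j, h6, h7, h8⟩ := h1 t₀ ((sat_triggerFormula hI h hge h3).mp h4)
      exact h5 j h6 h7 h8
  · intro h1 t ht
    have h0 := hsub t ht
    rcases h1 with h1 | h1
    · have := h1 t ht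
      omega
    · by_contra! h2
      exact h1 ⟨t, h0.2, (sat_triggerFormula hI h h0.1 h0.2).mpr ht, h2⟩

/-! ### Base formulas of a single timing -/

theorem baseForm_of_ne {τ : BasicTiming AP} (hτ : τ ≠ .eventually) (cond : Option (BExpr AP))
    (res : BExpr AP) (left right : MTL AP) : baseForm τ cond res left right =
      .imp right (.prev (.sio (coreFormula τ cond res left) left)) := by
  cases τ <;> first | rfl | exact (hτ rfl).elim

theorem baseFormLast_of_ne {τ : BasicTiming AP} (hτ : τ ≠ .eventually) (cond : Option (BExpr AP))
    (res : BExpr AP) (left : MTL AP) : baseFormLast τ cond res left =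
      .sio (coreFormula τ cond res left) left := by
  cases τ <;> first | rfl | exact (hτ rfl).elim

theorem mem_timeSem_iff_baseFormLast {cond : Option (BExpr AP)} {res : BExpr AP}
    {τ : BasicTiming AP} {left : MTL AP} {I : NatInterval} (hI : I.ub ≤ ρ.last)
    (h : IsLeftOn (Sat entails ρ left) I) : I ∈ timeSem entails ρ cond res τ ↔
      Sat entails ρ (baseFormLast τ cond res left) I.ub := by
  rw [mem_timeSem hI]
  by_cases hτ : τ = .eventually
  · subst hτ
    rw [baseFormLast, Sat, ← imp_iff_not_or, imp_iff_right h.once_left]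
    cases cond with
    | none => exact holds_eventually_iff_coreFormulaNull h
    | some c => exact holds_eventually_iff_coreFormulaCond hI h
  · rw [baseFormLast_of_ne hτ, h.sio_iff]
    cases cond with
    | none => exact holds_iff_coreFormulaNull h hτ
    | some c => exact holds_iff_coreFormulaCond hI h hτ

/-- At a right endpoint only the `prev` remains to be removed. For `eventually`, `baseFormLast` has
a guard that `baseForm` lacks; `hl` discharges it. -/
theorem sat_baseForm_succ {cond : Option (BExpr AP)} {res : BExpr AP} {τ : BasicTiming AP}
    {left right : MTL AP} {t : ℕ} (hr : Sat entails ρ right (t + 1))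
    (hl : Sat entails ρ (.once none left) t) :
    Sat entails ρ (baseForm τ cond res left right) (t + 1) ↔
      Sat entails ρ (baseFormLast τ cond res left) t := by
  by_cases hτ : τ = .eventually
  · subst hτ
    simp only [baseForm, baseFormLast, Sat, hr, ← imp_iff_not_or, true_imp_iff]
    refine ⟨fun h _ => h.2, fun h => ⟨by omega, h hl⟩⟩
  · simp only [baseForm_of_ne hτ, baseFormLast_of_ne hτ, Sat, hr, ← imp_iff_not_or, true_imp_iff]
    exact ⟨fun h => h.2, fun h => ⟨by omega, h⟩⟩

/-! ### Bodies -/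

theorem mem_bodySem_iff_bodyBaseLast {cond : Option (BExpr AP)} {left : MTL AP} {I : NatInterval}
    (hI : I.ub ≤ ρ.last) (h : IsLeftOn (Sat entails ρ left) I) (b : Body AP) :
    I ∈ bodySem entails ρ cond b ↔ Sat entails ρ (bodyBaseLast cond left b) I.ub := by
  induction b with
  | single τ res => exact mem_timeSem_iff_baseFormLast hI h
  | and b₁ b₂ ih₁ ih₂ => exact and_congr ih₁ ih₂
  | or b₁ b₂ ih₁ ih₂ => exact or_congr ih₁ ih₂

theorem sat_bodyBase_succ {cond : Option (BExpr AP)} {left right : MTL AP} {t : ℕ}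
    (hr : Sat entails ρ right (t + 1)) (hl : Sat entails ρ (.once none left) t) (b : Body AP) :
    Sat entails ρ (bodyBase cond left right b) (t + 1) ↔
      Sat entails ρ (bodyBaseLast cond left b) t := by
  induction b with
  | single τ res => exact sat_baseForm_succ hr hl
  | and b₁ b₂ ih₁ ih₂ => exact and_congr ih₁ ih₂
  | or b₁ b₂ ih₁ ih₂ => exact or_congr ih₁ ih₂

/-- Every pair of the body is an implication with the same false premise, so conjunctions and
disjunctions of pairs hold too. -/
theorem sat_bodyBase_of_not_right {cond : Option (BExpr AP)} {left right : MTL AP} {t : ℕ}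
    (hr : ¬ Sat entails ρ right t) (b : Body AP) :
    Sat entails ρ (bodyBase cond left right b) t := by
  induction b with
  | single τ res => cases τ <;> exact Or.inl hr
  | and b₁ b₂ ih₁ ih₂ => exact ⟨ih₁, ih₂⟩
  | or b₁ b₂ ih₁ ih₂ => exact Or.inl ih₁

/-- Covers the scopes without a right endpoint whose left endpoint never occurs: there are no
intervals, and the formula must hold vacuously. -/
theorem sat_bodyBaseLast_of_not_once_left {cond : Option (BExpr AP)} {left : MTL AP} {t : ℕ}
    (hl : ¬ Sat entails ρ (.once none left) t) (b : Body AP) :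
    Sat entails ρ (bodyBaseLast cond left b) t := by
  induction b with
  | single τ res => cases τ <;> exact Or.inl hl
  | and b₁ b₂ ih₁ ih₂ => exact ⟨ih₁, ih₂⟩
  | or b₁ b₂ ih₁ ih₂ => exact Or.inl ih₁

/-! ### From single intervals to the whole trace -/

theorem IsDelimited.isLeftOn {L E : ℕ → Prop} {n : ℕ} {l : List NatInterval}
    (h : IsDelimited L E n l) {I : NatInterval} (hI : I ∈ l) : IsLeftOn L I where
  iff_eq := h.left_iff I hI
  not_pred h0 hL := by
    refine h.left_succ _ hL ?_
    rw [show I.lb - 1 + 1 = I.lb by omega]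
    exact (h.left_iff I hI _ le_rfl I.le).mpr rfl

theorem forall_mem_bodySem_iff_of_right {left right : MTL AP} {l : List NatInterval}
    {cond : Option (BExpr AP)} {b : Body AP}
    (h : IsDelimited (Sat entails ρ left) (Sat entails ρ right) ρ.last l) :
    (∀ I ∈ l, I ∈ bodySem entails ρ cond b) ↔
      Sat entails ρ (.and (.hist none (.or (bodyBase cond left right b) ftp))
        (.imp (.sir (.not right) left) (bodyBaseLast cond left b))) ρ.last := by
  have hb : ∀ I ∈ l, (I ∈ bodySem entails ρ cond b ↔
      Sat entails ρ (bodyBaseLast cond left b) I.ub) :=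
    fun I hI => mem_bodySem_iff_bodyBaseLast (h.ub_le I hI) (h.isLeftOn hI) b
  simp only [Sat, InBound, and_true, sat_ftp, ← imp_iff_not_or, sat_sir]
  constructor
  · intro hl
    refine ⟨fun t ht => ?_, ?_⟩
    · by_cases h0 : t = 0
      · exact Or.inr h0
      left
      by_cases hr : Sat entails ρ right t
      · obtain ⟨I, hI, rfl⟩ := h.exists_of_right t ht h0 hr
        exact (sat_bodyBase_succ hr (h.isLeftOn hI).once_left b).mpr ((hb I hI).mp (hl I hI))
      · exact sat_bodyBase_of_not_right hr b
    · rintro ⟨t₀, h1, h2, h3⟩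
      obtain ⟨I, hI, hu⟩ := h.exists_of_left t₀ h1 h2 h3
      exact hu ▸ (hb I hI).mp (hl I hI)
  · rintro ⟨h1, h2⟩ I hI
    rw [hb I hI]
    by_cases hu : I.ub = ρ.last
    · rw [hu]
      -- `I.lb` witnesses that the interval is still open at the end of the trace, which is the
      -- premise of the second conjunct.
      exact h2 ⟨I.lb, hu ▸ I.le, (h.isLeftOn hI).lb,
        fun x hx hxn => h.not_right I hI x hx (hu ▸ hxn)⟩
    · have hr := (h.ub_eq_or I hI).resolve_left hu
      have hle := h.ub_le I hI
      rw [← sat_bodyBase_succ hr (h.isLeftOn hI).once_left b]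
      -- The first conjunct is read at the right endpoint `I.ub + 1`, which is positive, so `ftp` is
      -- false there.
      exact (h1 (I.ub + 1) (by omega)).resolve_right (by omega)

theorem forall_mem_bodySem_iff_of_not_right {left : MTL AP} {E : ℕ → Prop} {l : List NatInterval}
    {cond : Option (BExpr AP)} {b : Body AP} (hE : ∀ t, ¬ E t)
    (h : IsDelimited (Sat entails ρ left) E ρ.last l) :
    (∀ I ∈ l, I ∈ bodySem entails ρ cond b) ↔
      Sat entails ρ (bodyBaseLast cond left b) ρ.last := by
  have hb : ∀ I ∈ l, (I ∈ bodySem entails ρ cond b ↔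
      Sat entails ρ (bodyBaseLast cond left b) ρ.last) := by
    intro I hI
    rw [← (h.ub_eq_or I hI).resolve_right (hE _)]
    exact mem_bodySem_iff_bodyBaseLast (h.ub_le I hI) (h.isLeftOn hI) b
  constructor
  · intro hl
    by_cases hL : Sat entails ρ (.once none left) ρ.last
    · obtain ⟨t, ht, hLt⟩ := sat_once.mp hL
      obtain ⟨I, hI, -⟩ := h.exists_of_left t ht hLt fun x _ _ => hE x
      exact (hb I hI).mp (hl I hI)
    · exact sat_bodyBaseLast_of_not_once_left hL b
  · intro hl I hI
    exact (hb I hI).mpr hl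

end
end Fret

theorem mainTheorem1 {AP : Type*} (entails : Set AP → AP → Prop)
    (r : Fret.Requirement AP) (ρ : Fret.Trace AP) :
    ρ ∈ Fret.fretSem entails r ↔ Fret.Models entails ρ (Fret.genform r) := by
  have h := Fret.isDelimited_scopeSem (entails := entails) (ρ := ρ) r.scope
  rw [Fret.Models, Fret.genform]
  split
  · next hr => exact Fret.forall_mem_bodySem_iff_of_not_right (by simp [Fret.Scope.rightSat, hr]) h
  · next right hr =>
    exact Fret.forall_mem_bodySem_iff_of_right
      (h.congr (fun _ => Iff.rfl) (by simp [Fret.Scope.rightSat, hr]))
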